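/- Let $\mathbf T^d=\mathbb R^d/\mathbb Z^d$ be the flat unit torus with the norm $\|x\|$ induced by the $\ell_\infty$ norm, and let $F_{\rm in},F_{\rm out}:\mathbf T^d\to[0,1]$ be measurable functions such that $F_{\rm in}(x)$ and $F_{\rm out}(x)$ depend only on $\|x\|$. Write $\widehat F(k)=\int_{\mathbf T^d}F(x)e^{-2i\pi\langle k,x\rangle}\,dx$ for $k\in\mathbb Z^d$, $\mu_{\rm in}=\int_{\mathbf T^d} F_{\rm in}(x)\,dx$ and $\mu_{\rm out}=\int_{\mathbf T^d} F_{\rm out}(x)\,dx$. For even $n$, consider the Soft Geometric Block Model on $[n]$: the labelling $\sigma\in\{1,2\}^n$ is uniformly distributed over the labellings with exactly $n/2$ nodes of each label; independently of it, the positions $X_1,\dots,X_n$ are independent and uniform on $\mathbf T^d$; and, conditionally on $(\sigma,X)$, the edges $\{i,j\}$, $i<j$, of the random graph with adjacency matrix $A=(a_{ij})$ are present independently, with probability $F_{\rm in}(X_i-X_j)$ if $\sigma_i=\sigma_j$ and $F_{\rm out}(X_i-X_j)$ otherwise. Consider the following algorithm, with input $A,\mu_{\rm in},\mu_{\rm out}$.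 (1) Let $\widetilde\lambda$ be an eigenvalue of $A$ closest to $\frac{\mu_{\rm in}-\mu_{\rm out}}2\,n$, and let $\widetilde v\in\mathbb R^n$ be an associated eigenvector; set $\widetilde\sigma_i=1$ if $\widetilde v_i>0$ and $\widetilde\sigma_i=2$ otherwise. (2) For each $i\in[n]$ let $\widehat\sigma_i\in\operatorname{argmax}_{k\in\{1,2\}}\sum_{j\neq i}1(\widetilde\sigma_j=k)\,a_{ij}$. All choices in the algorithm (of $\widetilde\lambda$ and of $\widehat\sigma_i$ in case of ties, and of $\widetilde v$) may be made arbitrarily, as functions of $A$. Assume that $\mu_{\rm in}\neq\mu_{\rm out}$ and that $$\widehat F_{\rm in}(k)+\widehat F_{\rm out}(k)\neq\mu_{\rm in}-\mu_{\rm out}\quad\text{for all }k\in\mathbb Z^d,$$ $$\widehat F_{\rm in}(k)-\widehat F_{\rm out}(k)\neq\mu_{\rm in}-\mu_{\rm out}\quad\text{for all }k\in\mathbb Z^d\setminus\{0\}.$$ Then the algorithm achieves exact recovery: with $\ell(\sigma,\widehat\sigma)=\frac1n\min_{\pi\in\mathcal S_2}\sum_{i=1}^n 1(\sigma_i\neq\pi(\widehat\sigma_i))$,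 one has $$\lim_{n\to\infty,\ n\text{ even}}\mathbb P\big(\ell(\sigma,\widehat\sigma)>0\big)=0.$$ -/

import Mathlib

open MeasureTheory Filter Topology ProbabilityTheory

noncomputable section

namespace SGBM

/-- The flat unit torus `ℝ^d / ℤ^d`. Mathlib's norm on it is the maximum over the coordinates of
the distance to the nearest integer. -/
abbrev Torus (d : ℕ) := UnitAddTorus (Fin d)

/-- The uniform probability measure `dx` on the torus. -/
abbrev unif (d : ℕ) : Measure (Torus d) := Measure.pi fun _ => AddCircle.haarAddCircle

/-- Node labellings with two communities, numbered `0` and `1`. -/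
abbrev Labelling (n : ℕ) := Fin n → Fin 2

/-- A connectivity probability function: measurable, `[0,1]`-valued, and depending only on the
norm of its argument. -/
structure IsConnectivityFunction {d : ℕ} (F : Torus d → ℝ) : Prop where
  measurable : Measurable F
  mem_unit : ∀ x, 0 ≤ F x ∧ F x ≤ 1
  radial : ∀ x y, ‖x‖ = ‖y‖ → F x = F y

/-- The Fourier coefficient `∫ F(x) exp(-2πi⟨k,x⟩) dx` of a real function on the torus. -/
def fourier {d : ℕ} (F : Torus d → ℝ) (k : Fin d → ℤ) : ℂ :=
  UnitAddTorus.mFourierCoeff (fun x => (F x : ℂ)) k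

/-- The edge density `μ = ∫ F(x) dx`. -/
def edgeDensity {d : ℕ} (F : Torus d → ℝ) : ℝ := ∫ x, F x ∂unif d

/-- The labellings with two communities of equal size. -/
def balanced (n : ℕ) : Set (Labelling n) :=
  {σ | Nat.card {i // σ i = 0} = Nat.card {i // σ i = 1}}

/-- The probability of an edge between two nodes with labels `s`, `t` whose positions differ
by `x`. -/
def connectivity {d : ℕ} (Fi Fo : Torus d → ℝ) (x : Torus d) (s t : Fin 2) : ℝ :=
  if s = t then Fi x else Fo x

open Classical in
/-- The conditional probability of the graph `G` given the labelling and the positions: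
edges are independent over the pairs `i < j`. -/
def graphProb {d n : ℕ} (Fi Fo : Torus d → ℝ) (σ : Labelling n) (X : Fin n → Torus d)
    (G : SimpleGraph (Fin n)) : ℝ :=
  ∏ p : Fin n × Fin n with p.1 < p.2,
    if G.Adj p.1 p.2 then connectivity Fi Fo (X p.1 - X p.2) (σ p.1) (σ p.2)
    else 1 - connectivity Fi Fo (X p.1 - X p.2) (σ p.1) (σ p.2)

/-- The joint law of (labelling, positions, graph) in the soft geometric block model on `n` nodes:
the labelling is uniform over the balanced labellings, the positions are independent, uniform on
the torus and independent of the labelling, and the graph has the conditional law `graphProb`. -/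
def law {d : ℕ} (n : ℕ) (Fi Fo : Torus d → ℝ) :
    Measure ((Labelling n × (Fin n → Torus d)) × SimpleGraph (Fin n)) :=
  ∑ G : SimpleGraph (Fin n),
    (((uniformOn (balanced n)).prod (Measure.pi fun _ : Fin n => unif d)).withDensity
      (fun ω => ENNReal.ofReal (graphProb Fi Fo ω.1 ω.2 G))).map (fun ω => (ω, G))

open Classical in
/-- The proportion of misclassified nodes, up to a global permutation of the labels. -/
def loss {n : ℕ} (σ τ : Labelling n) : ℝ :=
  ((⨅ π : Equiv.Perm (Fin 2), Finset.card {i | σ i ≠ π (τ i)} : ℕ) : ℝ) / n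

open Classical in
/-- `τ` is an output of higher-order spectral clustering on the graph `G` with parameters
`μin, μout`: `τ` is read off the signs of an eigenvector `v` for an eigenvalue `lam` of the adjacency
matrix that is closest to `(μin - μout) / 2 * n`. -/
def IsHOSCOutput {n : ℕ} (μin μout : ℝ) (G : SimpleGraph (Fin n)) (τ : Labelling n) : Prop :=
  ∃ (lam : ℝ) (v : Fin n → ℝ),
    Module.End.HasEigenvector (Matrix.toLin' (G.adjMatrix ℝ)) lam v ∧
    (∀ lam' : ℝ, Module.End.HasEigenvalue (Matrix.toLin' (G.adjMatrix ℝ)) lam' →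
      |lam - (μin - μout) / 2 * n| ≤ |lam' - (μin - μout) / 2 * n|) ∧
    ∀ i, τ i = if 0 < v i then 0 else 1

open Classical in
/-- The number of neighbours of `i` that `τ` puts in community `k`. -/
def neighbourCount {n : ℕ} (G : SimpleGraph (Fin n)) (τ : Labelling n) (i : Fin n) (k : Fin 2) :
    ℕ :=
  Finset.card {j | j ≠ i ∧ τ j = k ∧ G.Adj i j}

/-- `τ` is an output of higher-order spectral clustering with local improvement: every node is
put in a community in which it has the most neighbours, according to an output `τ₀` of
higher-order spectral clustering. Ties are broken arbitrarily. -/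
def IsHOSCLIOutput {n : ℕ} (μin μout : ℝ) (G : SimpleGraph (Fin n)) (τ : Labelling n) : Prop :=
  ∃ τ₀ : Labelling n, IsHOSCOutput μin μout G τ₀ ∧
    ∀ i k, neighbourCount G τ₀ i k ≤ neighbourCount G τ₀ i (τ i)

/-- Strong consistency (exact recovery) of a sequence of estimators of the labelling from the
graph: the probability that the loss is positive tends to `0` along the even numbers of nodes. -/
def StronglyConsistent {d : ℕ} (Fi Fo : Torus d → ℝ)
    (est : ∀ n : ℕ, SimpleGraph (Fin n) → Labelling n) : Prop :=
  Tendsto (fun m : ℕ => law (2 * m) Fi Fo {ω | 0 < loss ω.1.1 (est (2 * m) ω.2)})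
    atTop (𝓝 0)

end SGBM

end

open MeasureTheory Filter Topology ProbabilityTheory

noncomputable section

namespace SGBM

/-! Divided by `n`, the adjacency matrix is close in operator norm to a discretisation of the
integral operator on torus × {labels} with kernel `connectivity`. Characters diagonalise this
operator: its eigenfunctions are the characters and the characters times the label sign, with
eigenvalues `(fourier Fi k ± fourier Fo k) / 2`. The label sign itself belongs to `k = 0` and the
minus sign, with eigenvalue `L = (μin - μout) / 2`. The hypotheses say that no other pair gives the
eigenvalue `L` and that `L ≠ 0`; as Fourier coefficients tend to zero, `L` is then isolated by a gap
`γ` (`exists_gap`).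

Four events of high probability make this quantitative. Signed degrees are uniformly close to their
means (`law_exists_deviation_le`), so `σ` is an approximate eigenvector in sup norm and the selected
eigenvalue is close to `L * n`. The centred adjacency matrix has operator norm `o(n)`
(`law_noise_le`). Truncating the Fourier series costs little in Frobenius norm
(`law_truncError_le`). The discretised eigenfunctions are almost orthonormal
(`law_not_almostOrthonormal_le`).

On these events the rest is deterministic (`loss_eq_zero_of_good`). An eigenvector for an eigenvalue
near `L * n` is almost proportional to `σ` (`AlmostOrthonormal.norm_smul_sub_le`), so its signs err
on a small fraction of the nodes. Each error moves a signed neighbour count by at most 2, while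
every true signed count has size about `|L| * n`; the majority vote is therefore right at all nodes
simultaneously (`loss_eq_zero_of_majority`). Since this holds for any labelling with few errors, the
dependence between the spectral step and the graph is harmless. -/

/-! ### Independent edges: expectations of products and the moment of the noise -/

open Classical in
/-- The probability of the graph `G` when the edges `i < j` are present independently with
probabilities `P i j`. -/
def bernoulliProb {n : ℕ} (P : Fin n → Fin n → ℝ) (G : SimpleGraph (Fin n)) : ℝ :=
  ∏ p : Fin n × Fin n with p.1 < p.2, if G.Adj p.1 p.2 then P p.1 p.2 else 1 - P p.1 p.2

/-- The pair `i, j` in increasing order. -/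
def edge {n : ℕ} (i j : Fin n) : Fin n × Fin n := (min i j, max i j)

lemma edge_eq_iff {n : ℕ} {i j k l : Fin n} :
    edge i j = edge k l ↔ (i = k ∧ j = l) ∨ (i = l ∧ j = k) := by
  simp only [edge, Prod.mk.injEq]
  constructor
  · rintro ⟨h1, h2⟩
    rcases le_total i j with h | h <;> rcases le_total k l with h' | h' <;> simp_all
  · rintro (⟨rfl, rfl⟩ | ⟨rfl, rfl⟩)
    · simp
    · simp [min_comm, max_comm]

lemma edge_lt {n : ℕ} {i j : Fin n} (h : i ≠ j) : (edge i j).1 < (edge i j).2 := by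
  simp [edge, h.symm]

lemma adj_edge {n : ℕ} (G : SimpleGraph (Fin n)) (i j : Fin n) :
    G.Adj (edge i j).1 (edge i j).2 ↔ G.Adj i j := by
  rcases le_total i j with h | h <;> simp [edge, h, G.adj_comm]

lemma apply_edge {n : ℕ} {P : Fin n → Fin n → ℝ} (hP : ∀ i j, P i j = P j i) (i j : Fin n) :
    P (edge i j).1 (edge i j).2 = P i j := by
  rcases le_total i j with h | h <;> simp [edge, h, hP j i]

-- Expanding the product on the right gives a sum over sets of increasing pairs, and these sets are
-- exactly the edge sets of simple graphs.
open Classical in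
lemma sum_prod_adj {n : ℕ} (a b : Fin n × Fin n → ℝ) :
    ∑ G : SimpleGraph (Fin n), ∏ p : Fin n × Fin n with p.1 < p.2,
      (if G.Adj p.1 p.2 then a p else b p) =
    ∏ p : Fin n × Fin n with p.1 < p.2, (a p + b p) := by
  rw [Finset.prod_add]
  refine Finset.sum_bij'
    (fun G _ => Finset.univ.filter fun p => p.1 < p.2 ∧ G.Adj p.1 p.2)
    (fun t _ => SimpleGraph.fromRel fun i j => i < j ∧ (i, j) ∈ t) ?_ ?_ ?_ ?_ ?_
  · intro G _
    simp only [Finset.mem_powerset]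
    intro p hp
    simp only [Finset.mem_filter, Finset.mem_univ, true_and] at hp ⊢
    exact hp.1
  · simp
  · intro G _
    ext i j
    simp only [SimpleGraph.fromRel_adj, Finset.mem_filter, Finset.mem_univ, true_and]
    constructor
    · rintro ⟨_, h | h⟩
      · exact h.2.2
      · exact h.2.2.symm
    · intro h
      refine ⟨h.ne, ?_⟩
      rcases lt_or_gt_of_ne h.ne with h' | h'
      · exact Or.inl ⟨h', h', h⟩
      · exact Or.inr ⟨h', h', h.symm⟩
  · intro t ht
    ext p
    have ht' : p ∈ t → p.1 < p.2 := fun hp => by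
      simpa using Finset.mem_powerset.1 ht hp
    simp only [SimpleGraph.fromRel_adj, Finset.mem_filter, Finset.mem_univ, true_and]
    constructor
    · rintro ⟨h, _, h' | h'⟩
      · exact h'.2
      · exact absurd h (not_lt.2 h'.1.le)
    · intro h
      exact ⟨ht' h, (ht' h).ne, Or.inl ⟨ht' h, h⟩⟩
  · intro G _
    rw [Finset.prod_ite]
    congr 1
    · congr 1
      ext p
      simp
    · congr 1
      ext p
      simp only [Finset.mem_filter, Finset.mem_univ, true_and, Finset.mem_sdiff]
      tauto

lemma sum_bernoulliProb {n : ℕ} (P : Fin n → Fin n → ℝ) :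
    ∑ G : SimpleGraph (Fin n), bernoulliProb P G = 1 := by
  classical
  refine (sum_prod_adj (fun p => P p.1 p.2) (fun p => 1 - P p.1 p.2)).trans ?_
  exact Finset.prod_eq_one fun p _ => by ring

lemma bernoulliProb_nonneg {n : ℕ} {P : Fin n → Fin n → ℝ} (hP : ∀ i j, 0 ≤ P i j ∧ P i j ≤ 1)
    (G : SimpleGraph (Fin n)) : 0 ≤ bernoulliProb P G := by
  classical
  refine Finset.prod_nonneg fun p _ => ?_
  have := hP p.1 p.2
  split_ifs <;> linarith

-- Expectation of a product of edge functions. Several `r` may sit on the same undirected edge, so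
-- factors are first grouped by edge; distinct edges are independent, and edges without a factor
-- contribute `P + (1 - P) = 1`.
open Classical in
lemma sum_bernoulliProb_mul_prod {n : ℕ} (P : Fin n → Fin n → ℝ) {R : Type*} (s : Finset R)
    (u w : R → Fin n) (huw : ∀ r ∈ s, u r ≠ w r) (a b : R → ℝ) :
    ∑ G : SimpleGraph (Fin n), bernoulliProb P G *
      ∏ r ∈ s, (if G.Adj (u r) (w r) then a r else b r) =
    ∏ p : Fin n × Fin n with p.1 < p.2,
      (P p.1 p.2 * ∏ r ∈ s with edge (u r) (w r) = p, a r +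
        (1 - P p.1 p.2) * ∏ r ∈ s with edge (u r) (w r) = p, b r) := by
  rw [← sum_prod_adj]
  refine Finset.sum_congr rfl fun G _ => ?_
  rw [← Finset.prod_fiberwise_of_maps_to (s := s) (t := {p : Fin n × Fin n | p.1 < p.2})
    (g := fun r => edge (u r) (w r)), bernoulliProb, ← Finset.prod_mul_distrib]
  · refine Finset.prod_congr rfl fun p _ => ?_
    have : ∀ c d : R → ℝ, (∀ r ∈ s, edge (u r) (w r) = p → c r = d r) →
        ∏ r ∈ s with edge (u r) (w r) = p, c r = ∏ r ∈ s with edge (u r) (w r) = p, d r :=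
      fun c d h => Finset.prod_congr rfl fun r hr => by
        rw [Finset.mem_filter] at hr
        exact h r hr.1 hr.2
    by_cases h : G.Adj p.1 p.2
    · rw [if_pos h, if_pos h, this]
      intro r _ hr
      rw [if_pos]
      rw [← adj_edge, hr]
      exact h
    · rw [if_neg h, if_neg h, this]
      intro r _ hr
      rw [if_neg]
      rw [← adj_edge, hr]
      exact h
  · intro r hr
    simpa using edge_lt (huw r hr)

open Classical in
lemma sum_bernoulliProb_mul_prod_of_injOn {n : ℕ} {P : Fin n → Fin n → ℝ}
    (hP : ∀ i j, P i j = P j i) {R : Type*} (s : Finset R)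
    (u w : R → Fin n) (huw : ∀ r ∈ s, u r ≠ w r)
    (hinj : Set.InjOn (fun r => edge (u r) (w r)) s) (a b : R → ℝ) :
    ∑ G : SimpleGraph (Fin n), bernoulliProb P G *
      ∏ r ∈ s, (if G.Adj (u r) (w r) then a r else b r) =
    ∏ r ∈ s, (P (u r) (w r) * a r + (1 - P (u r) (w r)) * b r) := by
  rw [sum_bernoulliProb_mul_prod P s u w huw]
  rw [← Finset.prod_subset (s₁ := s.image fun r => edge (u r) (w r))]
  · rw [Finset.prod_image hinj]
    refine Finset.prod_congr rfl fun r hr => ?_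
    have : ({r' ∈ s | edge (u r') (w r') = edge (u r) (w r)} : Finset R) = {r} := by
      ext r'
      simp only [Finset.mem_filter, Finset.mem_singleton]
      constructor
      · rintro ⟨h1, h2⟩
        exact hinj h1 hr h2
      · rintro rfl
        exact ⟨hr, rfl⟩
    rw [this, apply_edge hP]
    simp
  · intro p hp
    obtain ⟨r, hr, rfl⟩ := Finset.mem_image.1 hp
    simpa using edge_lt (huw r hr)
  · intro p _ hp
    have : ({r ∈ s | edge (u r) (w r) = p} : Finset R) = ∅ := by
      refine Finset.filter_eq_empty_iff.2 fun r hr h => hp (Finset.mem_image.2 ⟨r, hr, h⟩)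
    rw [this]
    simp

open Classical in
/-- The centred adjacency matrix. -/
def noise {n : ℕ} (P : Fin n → Fin n → ℝ) (G : SimpleGraph (Fin n)) (i j : Fin n) : ℝ :=
  if i = j then 0 else if G.Adj i j then 1 - P i j else -P i j

lemma abs_noise_le {n : ℕ} {P : Fin n → Fin n → ℝ} (hP : ∀ i j, 0 ≤ P i j ∧ P i j ≤ 1)
    (G : SimpleGraph (Fin n)) (i j : Fin n) : |noise P G i j| ≤ 1 := by
  have := hP i j
  unfold noise
  split_ifs <;> rw [abs_le] <;> constructor <;> linarith

lemma sum_bernoulliProb_mul_noise_le_one {n : ℕ} {P : Fin n → Fin n → ℝ}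
    (hP : ∀ i j, 0 ≤ P i j ∧ P i j ≤ 1) (u w : Fin 4 → Fin n) :
    ∑ G : SimpleGraph (Fin n), bernoulliProb P G * ∏ r, noise P G (u r) (w r) ≤ 1 := by
  rw [← sum_bernoulliProb P]
  refine Finset.sum_le_sum fun G _ => ?_
  refine mul_le_of_le_one_right (bernoulliProb_nonneg hP G) ((le_abs_self _).trans ?_)
  rw [Finset.abs_prod]
  exact Finset.prod_le_one (fun _ _ => abs_nonneg _) fun r _ => abs_noise_le hP G _ _

/-- An edge that occurs once among the factors contributes its own centred mean, `P (1 - P) + (1 -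
P) (-P) = 0`. If some pair is a loop, the noise vanishes by definition. -/
lemma sum_bernoulliProb_mul_noise_eq_zero {n : ℕ} {P : Fin n → Fin n → ℝ}
    (hP : ∀ i j, P i j = P j i) (u w : Fin 4 → Fin n)
    (h : ∀ r, r ≠ 0 → edge (u r) (w r) ≠ edge (u 0) (w 0)) :
    ∑ G : SimpleGraph (Fin n), bernoulliProb P G * ∏ r, noise P G (u r) (w r) = 0 := by
  classical
  by_cases huw : ∀ r, u r ≠ w r
  · have : ∀ G : SimpleGraph (Fin n), ∏ r, noise P G (u r) (w r) =
        ∏ r, if G.Adj (u r) (w r) then 1 - P (u r) (w r) else -P (u r) (w r) := fun G =>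
      Finset.prod_congr rfl fun r _ => if_neg (huw r)
    simp_rw [this]
    rw [sum_bernoulliProb_mul_prod P Finset.univ u w (fun r _ => huw r)]
    refine Finset.prod_eq_zero (i := edge (u 0) (w 0)) (by simpa using edge_lt (huw 0)) ?_
    have : ({r | edge (u r) (w r) = edge (u 0) (w 0)} : Finset (Fin 4)) = {0} := by
      ext r
      simp only [Finset.mem_filter, Finset.mem_univ, true_and, Finset.mem_singleton]
      exact ⟨fun hr => by_contra fun h0 => h r h0 hr, fun hr => by rw [hr]⟩
    rw [this, apply_edge hP]
    simp only [Finset.prod_singleton]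
    ring
  · push Not at huw
    obtain ⟨r, hr⟩ := huw
    refine Finset.sum_eq_zero fun G _ => ?_
    rw [Finset.prod_eq_zero (Finset.mem_univ r) (by simp [noise, hr]), mul_zero]

/-- The squared Frobenius norm of the square of the centred adjacency matrix has expectation at
most `2 n³`. -/
lemma sum_bernoulliProb_mul_noise_sq_le {n : ℕ} {P : Fin n → Fin n → ℝ}
    (hP : ∀ i j, 0 ≤ P i j ∧ P i j ≤ 1) (hsymm : ∀ i j, P i j = P j i) :
    ∑ G : SimpleGraph (Fin n), bernoulliProb P G *
      ∑ i, ∑ j, (∑ k, noise P G k i * noise P G k j) ^ 2 ≤ 2 * (n : ℝ) ^ 3 := by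
  have key : ∀ i j k l : Fin n, ∑ G : SimpleGraph (Fin n), bernoulliProb P G *
      (noise P G k i * noise P G k j * (noise P G l i * noise P G l j)) ≤
      (if i = j then 1 else 0) + (if k = l then 1 else 0) := by
    intro i j k l
    have hprod : ∀ G : SimpleGraph (Fin n),
        noise P G k i * noise P G k j * (noise P G l i * noise P G l j) =
        ∏ r, noise P G ((![k, k, l, l] : Fin 4 → Fin n) r)
          ((![i, j, i, j] : Fin 4 → Fin n) r) := fun G => by
      simp [Fin.prod_univ_four]
      ring
    by_cases h : i ≠ j ∧ k ≠ l
    · rw [if_neg h.1, if_neg h.2]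
      -- For `i ≠ j` and `k ≠ l` this is the only way in which the edge `{k, i}` recurs, as `{l,
      -- j}`; then `noise P G k j` lies on the diagonal and is zero.
      by_cases hki : k = j ∧ i = l
      · obtain ⟨rfl, rfl⟩ := hki
        simp [noise]
      · simp_rw [hprod]
        rw [sum_bernoulliProb_mul_noise_eq_zero hsymm]
        · simp
        · intro r hr
          fin_cases r <;> simp_all [edge_eq_iff] <;> grind
    · refine (?_ : _ ≤ (1 : ℝ)).trans ?_
      · simp_rw [hprod]
        exact sum_bernoulliProb_mul_noise_le_one hP _ _
      · split_ifs <;> simp_all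
  calc _ = ∑ i, ∑ j, ∑ k, ∑ l, ∑ G : SimpleGraph (Fin n), bernoulliProb P G *
      (noise P G k i * noise P G k j * (noise P G l i * noise P G l j)) := by
        simp_rw [sq, Finset.sum_mul_sum, Finset.mul_sum]
        rw [Finset.sum_comm]
        refine Finset.sum_congr rfl fun i _ => ?_
        rw [Finset.sum_comm]
        refine Finset.sum_congr rfl fun j _ => ?_
        rw [Finset.sum_comm]
        refine Finset.sum_congr rfl fun k _ => ?_
        rw [Finset.sum_comm]
    _ ≤ ∑ i : Fin n, ∑ j : Fin n, ∑ k : Fin n, ∑ l : Fin n,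
        (((if i = j then 1 else 0) + (if k = l then 1 else 0) : ℝ)) :=
        Finset.sum_le_sum fun i _ => Finset.sum_le_sum fun j _ => Finset.sum_le_sum fun k _ =>
          Finset.sum_le_sum fun l _ => key i j k l
    _ = _ := by
        simp [Finset.sum_add_distrib]
        ring

/-! ### The joint law and Markov's inequality -/

instance {n : ℕ} : MeasurableSingletonClass (SimpleGraph (Fin n)) := by
  refine ⟨fun G => ⟨{G.Adj}, measurableSet_singleton _, ?_⟩⟩
  ext G'
  simp only [Set.mem_preimage, Set.mem_singleton_iff, SimpleGraph.adj_inj]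

/-- The matrix of conditional edge probabilities. -/
def edgeProb {d n : ℕ} (Fi Fo : Torus d → ℝ) (σ : Labelling n) (X : Fin n → Torus d)
    (i j : Fin n) : ℝ :=
  connectivity Fi Fo (X i - X j) (σ i) (σ j)

lemma graphProb_eq {d n : ℕ} (Fi Fo : Torus d → ℝ) (σ : Labelling n) (X : Fin n → Torus d)
    (G : SimpleGraph (Fin n)) :
    graphProb Fi Fo σ X G = bernoulliProb (edgeProb Fi Fo σ X) G := rfl

section

variable {d : ℕ} {Fi Fo : Torus d → ℝ} (hFi : IsConnectivityFunction Fi)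
  (hFo : IsConnectivityFunction Fo)

include hFi hFo

lemma connectivity_mem (x : Torus d) (s t : Fin 2) :
    0 ≤ connectivity Fi Fo x s t ∧ connectivity Fi Fo x s t ≤ 1 := by
  unfold connectivity
  split_ifs
  · exact hFi.mem_unit _
  · exact hFo.mem_unit _

lemma measurable_connectivity (s t : Fin 2) : Measurable fun x => connectivity Fi Fo x s t := by
  unfold connectivity
  split_ifs
  · exact hFi.measurable
  · exact hFo.measurable

lemma edgeProb_mem {n : ℕ} (σ : Labelling n) (X : Fin n → Torus d) (i j : Fin n) :
    0 ≤ edgeProb Fi Fo σ X i j ∧ edgeProb Fi Fo σ X i j ≤ 1 :=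
  connectivity_mem hFi hFo _ _ _

/-- Radiality enters only here, through `‖x‖ = ‖-x‖`. -/
lemma edgeProb_symm {n : ℕ} (σ : Labelling n) (X : Fin n → Torus d) (i j : Fin n) :
    edgeProb Fi Fo σ X i j = edgeProb Fi Fo σ X j i := by
  have h : ‖X i - X j‖ = ‖X j - X i‖ := norm_sub_rev _ _
  unfold edgeProb connectivity
  rw [hFi.radial _ _ h, hFo.radial _ _ h]
  simp only [eq_comm]

lemma measurable_edgeProb {n : ℕ} (i j : Fin n) :
    Measurable fun ω : Labelling n × (Fin n → Torus d) => edgeProb Fi Fo ω.1 ω.2 i j := by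
  refine measurable_from_prod_countable_right fun σ => ?_
  exact (measurable_connectivity hFi hFo (σ i) (σ j)).comp
    ((measurable_pi_apply i).sub (measurable_pi_apply j))

lemma measurable_graphProb {n : ℕ} (G : SimpleGraph (Fin n)) :
    Measurable fun ω : Labelling n × (Fin n → Torus d) => graphProb Fi Fo ω.1 ω.2 G := by
  unfold graphProb
  refine Finset.measurable_prod _ fun p _ => ?_
  split_ifs
  · exact measurable_edgeProb hFi hFo p.1 p.2
  · exact measurable_const.sub (measurable_edgeProb hFi hFo p.1 p.2)

/-- Markov's inequality for the joint law. -/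
lemma law_le {n : ℕ} {f : Labelling n × (Fin n → Torus d) → SimpleGraph (Fin n) → ℝ}
    (hf0 : ∀ ω G, 0 ≤ f ω G) (hfm : ∀ G, Measurable fun ω => f ω G)
    {g : Labelling n → (Fin n → Torus d) → ℝ} {C : ℝ}
    (hg : ∀ σ ∈ balanced n, ∀ X, ∑ G, graphProb Fi Fo σ X G * f (σ, X) G ≤ g σ X)
    (hgi : ∀ σ ∈ balanced n, Integrable (g σ) (Measure.pi fun _ => unif d))
    (hC : ∀ σ ∈ balanced n, ∫ X, g σ X ∂(Measure.pi fun _ => unif d) ≤ C) :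
    law n Fi Fo {p | 1 ≤ f p.1 p.2} ≤ ENNReal.ofReal C := by
  have hgp : ∀ σ X (G : SimpleGraph (Fin n)), 0 ≤ graphProb Fi Fo σ X G := fun σ X G => by
    rw [graphProb_eq]
    exact bernoulliProb_nonneg (edgeProb_mem hFi hFo σ X) G
  have hmeas : MeasurableSet {p : (Labelling n × (Fin n → Torus d)) × SimpleGraph (Fin n) |
      1 ≤ f p.1 p.2} := by
    refine measurableSet_le measurable_const ?_
    exact measurable_from_prod_countable_left fun G => hfm G
  have hm1 : ∀ G : SimpleGraph (Fin n), Measurable fun ω : Labelling n × (Fin n → Torus d) =>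
      ENNReal.ofReal (graphProb Fi Fo ω.1 ω.2 G) := fun G =>
    (measurable_graphProb hFi hFo G).ennreal_ofReal
  have hm2 : ∀ G : SimpleGraph (Fin n), Measurable fun ω : Labelling n × (Fin n → Torus d) =>
      ENNReal.ofReal (graphProb Fi Fo ω.1 ω.2 G * f ω G) := fun G =>
    ((measurable_graphProb hFi hFo G).mul (hfm G)).ennreal_ofReal
  set μ := (uniformOn (balanced n)).prod (Measure.pi fun _ : Fin n => unif d) with hμ
  calc law n Fi Fo {p | 1 ≤ f p.1 p.2}
      = ∑ G, ∫⁻ ω in {ω | 1 ≤ f ω G}, ENNReal.ofReal (graphProb Fi Fo ω.1 ω.2 G) ∂μ := by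
        rw [law, Measure.finsetSum_apply]
        refine Finset.sum_congr rfl fun G _ => ?_
        rw [Measure.map_apply (by fun_prop) hmeas]
        exact withDensity_apply _ (measurableSet_le measurable_const (hfm G))
    _ ≤ ∑ G, ∫⁻ ω, ENNReal.ofReal (graphProb Fi Fo ω.1 ω.2 G * f ω G) ∂μ := by
        refine Finset.sum_le_sum fun G _ => ?_
        refine (setLIntegral_mono (hm2 G) fun ω hω => ?_).trans (setLIntegral_le_lintegral _ _)
        exact ENNReal.ofReal_le_ofReal (le_mul_of_one_le_right (hgp _ _ _) hω)
    _ = ∫⁻ ω, ENNReal.ofReal (∑ G, graphProb Fi Fo ω.1 ω.2 G * f ω G) ∂μ := by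
        rw [← lintegral_finsetSum _ fun G _ => hm2 G]
        refine lintegral_congr fun ω => ?_
        rw [ENNReal.ofReal_sum_of_nonneg fun G _ => mul_nonneg (hgp _ _ _) (hf0 _ _)]
    _ = ∫⁻ σ, ∫⁻ X, ENNReal.ofReal (∑ G, graphProb Fi Fo σ X G * f (σ, X) G)
          ∂(Measure.pi fun _ => unif d) ∂(uniformOn (balanced n)) := by
        rw [hμ, lintegral_prod]
        exact (Finset.measurable_sum _ fun G _ =>
          (measurable_graphProb hFi hFo G).mul (hfm G)).ennreal_ofReal.aemeasurable
    _ ≤ ∫⁻ _, ENNReal.ofReal C ∂(uniformOn (balanced n)) := by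
        -- The bounds on `g` are assumed for balanced labellings only, which carry all the mass.
        refine lintegral_mono_ae ?_
        have : ∀ᵐ σ ∂(uniformOn (balanced n)), σ ∈ balanced n := by
          rw [ae_iff]
          refine (cond_apply (Set.toFinite _).measurableSet _ _).trans ?_
          rw [← Set.compl_def, Set.inter_compl_self, measure_empty, mul_zero]
        filter_upwards [this] with σ hσ
        have h0 : 0 ≤ g σ := fun X =>
          (Finset.sum_nonneg fun G _ => mul_nonneg (hgp _ _ _) (hf0 _ _)).trans (hg σ hσ X)
        calc _ ≤ ∫⁻ X, ENNReal.ofReal (g σ X) ∂(Measure.pi fun _ => unif d) :=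
              lintegral_mono fun X => ENNReal.ofReal_le_ofReal (hg σ hσ X)
          _ = ENNReal.ofReal (∫ X, g σ X ∂(Measure.pi fun _ => unif d)) :=
              (ofReal_integral_eq_lintegral_ofReal (hgi σ hσ) (ae_of_all _ h0)).symm
          _ ≤ _ := ENNReal.ofReal_le_ofReal (hC σ hσ)
    _ ≤ ENNReal.ofReal C := by
        rw [lintegral_const]
        -- Mass at most one is enough; for odd `n` no labelling is balanced and the measure is zero.
        refine mul_le_of_le_one_right zero_le ?_
        rw [uniformOn, cond_apply (Set.toFinite _).measurableSet, Set.inter_univ]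
        exact ENNReal.inv_mul_le_one _

end

/-! ### Differences of independent uniform points -/

instance {d : ℕ} : (unif d).IsNegInvariant := by
  have : (AddCircle.haarAddCircle (T := 1)).IsNegInvariant :=
    inferInstanceAs (Measure.addHaarMeasure _).IsNegInvariant
  infer_instance

lemma measurePreserving_unif_sub {d : ℕ} (x : Torus d) :
    MeasurePreserving (fun y => x - y) (unif d) (unif d) :=
  Measure.measurePreserving_sub_left _ x

/-- The differences with a fixed coordinate of independent uniform variables are independent and
uniform. -/
lemma measurePreserving_differences {d n : ℕ} (i : Fin (n + 1)) :
    MeasurePreserving (fun (X : Fin (n + 1) → Torus d) (j : Fin n) => X i - X (i.succAbove j))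
      (Measure.pi fun _ => unif d) (Measure.pi fun _ => unif d) := by
  have h1 := measurePreserving_piFinSuccAbove (fun _ : Fin (n + 1) => unif d) i
  have h2 : MeasurePreserving
      (fun p : Torus d × (Fin n → Torus d) => (p.1, fun j => p.1 - p.2 j))
      ((unif d).prod (Measure.pi fun _ => unif d))
      ((unif d).prod (Measure.pi fun _ => unif d)) := by
    refine (MeasurePreserving.id (unif d)).skew_product
      (g := fun x (y : Fin n → Torus d) j => x - y j) ?_ (ae_of_all _ fun x => ?_)
    · refine measurable_pi_lambda _ fun j => ?_
      exact measurable_fst.sub ((measurable_pi_apply j).comp measurable_snd)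
    · exact (measurePreserving_pi _ _ fun _ => measurePreserving_unif_sub x).map_eq
  exact (measurePreserving_snd.comp h2).comp h1

lemma measurePreserving_difference {d n : ℕ} {i j : Fin n} (h : i ≠ j) :
    MeasurePreserving (fun X : Fin n → Torus d => X i - X j)
      (Measure.pi fun _ => unif d) (unif d) := by
  cases n with
  | zero => exact i.elim0
  | succ n =>
    obtain ⟨k, rfl⟩ := Fin.exists_succAbove_eq h.symm
    exact (measurePreserving_eval (fun _ => unif d) k).comp (measurePreserving_differences i)

/-- This decouples the edges at a single node: although positions correlate the edges of the graph
as a whole, those at `i` depend on differences that are independent of one another. -/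
lemma integral_prod_differences {d n : ℕ} (i : Fin n) {h : Fin n → Torus d → ℝ}
    (hm : ∀ j, Measurable (h j)) :
    ∫ X : Fin n → Torus d, ∏ j ∈ Finset.univ.erase i, h j (X i - X j)
      ∂(Measure.pi fun _ => unif d) = ∏ j ∈ Finset.univ.erase i, ∫ x, h j x ∂(unif d) := by
  cases n with
  | zero => exact i.elim0
  | succ n =>
    have key : ∀ a : Fin (n + 1) → ℝ,
        ∏ j ∈ Finset.univ.erase i, a j = ∏ j : Fin n, a (i.succAbove j) := fun a => by
      have : Finset.univ.erase i = Finset.univ.map (Fin.succAboveEmb i) := by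
        ext j
        simp [Fin.exists_succAbove_eq_iff]
      rw [this, Finset.prod_map]
      rfl
    simp_rw [key]
    rw [← integral_fintype_prod_eq_prod,
      ← (measurePreserving_differences i).map_eq, integral_map]
    · exact (measurePreserving_differences i).measurable.aemeasurable
    · exact (Finset.measurable_prod _ fun j _ =>
        (hm _).comp (measurable_pi_apply j)).aestronglyMeasurable

/-! ### Label signs and concentration of signed degrees -/

/-- The label as a sign. -/
def sgn (s : Fin 2) : ℝ := if s = 0 then 1 else -1

lemma sgn_mul_self (s : Fin 2) : sgn s * sgn s = 1 := by
  fin_cases s <;> simp [sgn]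

lemma abs_sgn (s : Fin 2) : |sgn s| = 1 := by
  fin_cases s <;> simp [sgn]

lemma sum_sgn {n : ℕ} {σ : Labelling n} (hσ : σ ∈ balanced n) : ∑ i, sgn (σ i) = 0 := by
  classical
  have h : Nat.card {i // σ i = 0} = Nat.card {i // σ i = 1} := hσ
  rw [Nat.card_eq_fintype_card, Nat.card_eq_fintype_card, Fintype.card_subtype,
    Fintype.card_subtype] at h
  have h1 : ∀ i, sgn (σ i) = (if σ i = 0 then 1 else 0) - (if σ i = 1 then 1 else 0) := fun i => by
    generalize σ i = s
    fin_cases s <;> simp [sgn]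
  simp_rw [h1, Finset.sum_sub_distrib, Finset.sum_boole]
  rw [h, sub_self]

/-- Apply `exp y ≤ 1 + y + y ^ 2` for `|y| ≤ 1` to both terms: the linear parts cancel by centring,
and the quadratic parts add up to `m (1 - m) x ^ 2 ≤ x ^ 2`. -/
lemma bernoulli_mgf_le {m x : ℝ} (hm : 0 ≤ m ∧ m ≤ 1) (hx : |x| ≤ 1) :
    m * Real.exp (x * (1 - m)) + (1 - m) * Real.exp (x * (-m)) ≤ Real.exp (x ^ 2) := by
  have hb : ∀ y : ℝ, |y| ≤ 1 → Real.exp y ≤ 1 + y + y ^ 2 := fun y hy => by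
    have := (abs_le.1 (Real.abs_exp_sub_one_sub_id_le hy)).2
    linarith
  have h1 := hb (x * (1 - m)) (by
    rw [abs_mul]
    exact mul_le_one₀ hx (abs_nonneg _) (abs_le.2 ⟨by linarith, by linarith⟩))
  have h2 := hb (x * (-m)) (by
    rw [abs_mul]
    exact mul_le_one₀ hx (abs_nonneg _) (abs_le.2 ⟨by linarith, by linarith⟩))
  have h3 := Real.add_one_le_exp (x ^ 2)
  have h4 := mul_le_mul_of_nonneg_left h1 hm.1
  have h5 := mul_le_mul_of_nonneg_left h2 (sub_nonneg.2 hm.2)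
  have h6 : m * (1 - m) * x ^ 2 ≤ 1 * x ^ 2 :=
    mul_le_mul_of_nonneg_right (by nlinarith) (sq_nonneg _)
  nlinarith

section

variable {d : ℕ} {Fi Fo : Torus d → ℝ} (hFi : IsConnectivityFunction Fi)
  (hFo : IsConnectivityFunction Fo)

/-- The marginal edge probability. -/
def meanProb {d : ℕ} (Fi Fo : Torus d → ℝ) (s t : Fin 2) : ℝ :=
  ∫ x, connectivity Fi Fo x s t ∂unif d

include hFi hFo in
lemma integrable_connectivity (s t : Fin 2) :
    Integrable (fun x => connectivity Fi Fo x s t) (unif d) := by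
  refine Integrable.of_bound (measurable_connectivity hFi hFo s t).aestronglyMeasurable 1
    (ae_of_all _ fun x => ?_)
  have := connectivity_mem hFi hFo x s t
  rw [Real.norm_eq_abs, abs_le]
  constructor <;> linarith

include hFi hFo in
lemma meanProb_mem (s t : Fin 2) : 0 ≤ meanProb Fi Fo s t ∧ meanProb Fi Fo s t ≤ 1 := by
  refine ⟨integral_nonneg fun x => (connectivity_mem hFi hFo x s t).1, ?_⟩
  have := integral_mono (integrable_connectivity hFi hFo s t) (integrable_const 1)
    fun x => (connectivity_mem hFi hFo x s t).2
  simpa [meanProb] using this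

lemma meanProb_eq (s t : Fin 2) : meanProb Fi Fo s t =
    (edgeDensity Fi + edgeDensity Fo) / 2 +
      sgn s * sgn t * ((edgeDensity Fi - edgeDensity Fo) / 2) := by
  fin_cases s <;> fin_cases t <;> simp [meanProb, connectivity, sgn, edgeDensity] <;> ring

open Classical in
/-- The deviation of the signed degree of `i` from its mean. -/
def deviation {d n : ℕ} (Fi Fo : Torus d → ℝ) (σ : Labelling n) (G : SimpleGraph (Fin n))
    (i : Fin n) : ℝ :=
  ∑ j ∈ Finset.univ.erase i,
    sgn (σ j) * ((if G.Adj i j then 1 else 0) - meanProb Fi Fo (σ i) (σ j))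

-- Balance removes the label-independent half of `meanProb` from the sum. The last term on the right
-- is the mean of the missing summand `j = i`.
open Classical in
lemma deviation_eq {n : ℕ} {σ : Labelling n} (hσ : σ ∈ balanced n) (G : SimpleGraph (Fin n))
    (i : Fin n) : deviation Fi Fo σ G i = ∑ j, G.adjMatrix ℝ i j * sgn (σ j) -
      (edgeDensity Fi - edgeDensity Fo) / 2 * n * sgn (σ i) + edgeDensity Fi * sgn (σ i) := by
  have h1 : ∑ j, sgn (σ j) * meanProb Fi Fo (σ i) (σ j) =
      (edgeDensity Fi - edgeDensity Fo) / 2 * n * sgn (σ i) := by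
    calc _ = ∑ j, ((edgeDensity Fi + edgeDensity Fo) / 2 * sgn (σ j) +
          sgn (σ i) * ((edgeDensity Fi - edgeDensity Fo) / 2)) :=
          Finset.sum_congr rfl fun j _ => by
            rw [meanProb_eq]
            linear_combination
              sgn (σ i) * ((edgeDensity Fi - edgeDensity Fo) / 2) * sgn_mul_self (σ j)
      _ = _ := by
          rw [Finset.sum_add_distrib, ← Finset.mul_sum, sum_sgn hσ]
          simp
          ring
  have h2 : meanProb Fi Fo (σ i) (σ i) = edgeDensity Fi := by simp [meanProb, connectivity,
    edgeDensity]
  rw [deviation, Finset.sum_erase_eq_sub (Finset.mem_univ i)]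
  simp_rw [mul_sub, Finset.sum_sub_distrib, h1, h2, SimpleGraph.adjMatrix_apply, mul_comm (sgn _)]
  simp

-- Given the positions, the edges at `i` are independent, so the conditional moment generating
-- function is a product over `j` of functions of `X i - X j`. Independence of the differences lets
-- the integral pass inside, leaving centred Bernoulli variables of mean `meanProb`.
include hFi hFo in
lemma exp_deviation_integral_le {n : ℕ} (σ : Labelling n) (i : Fin n) {t : ℝ} (ht : |t| ≤ 1) :
    ∃ g : (Fin n → Torus d) → ℝ,
      (∀ X, ∑ G, graphProb Fi Fo σ X G * Real.exp (t * deviation Fi Fo σ G i) = g X) ∧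
      Integrable g (Measure.pi fun _ => unif d) ∧
      ∫ X, g X ∂(Measure.pi fun _ => unif d) ≤ Real.exp (t ^ 2 * n) := by
  classical
  set m : Fin n → ℝ := fun j => meanProb Fi Fo (σ i) (σ j) with hm
  set α : Fin n → ℝ := fun j => Real.exp (t * sgn (σ j) * (1 - m j)) with hα
  set β : Fin n → ℝ := fun j => Real.exp (t * sgn (σ j) * (-m j)) with hβ
  set h : Fin n → Torus d → ℝ := fun j x =>
    connectivity Fi Fo x (σ i) (σ j) * α j + (1 - connectivity Fi Fo x (σ i) (σ j)) * β j with hh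
  have hmeas : ∀ j, Measurable (h j) := fun j =>
    ((measurable_connectivity hFi hFo _ _).mul_const _).add
      ((measurable_const.sub (measurable_connectivity hFi hFo _ _)).mul_const _)
  have hbound : ∀ j x, 0 ≤ h j x ∧ h j x ≤ α j + β j := fun j x => by
    have h1 := connectivity_mem hFi hFo x (σ i) (σ j)
    have h2 : 0 < α j := Real.exp_pos _
    have h3 : 0 < β j := Real.exp_pos _
    constructor
    · exact add_nonneg (mul_nonneg h1.1 h2.le) (mul_nonneg (by linarith) h3.le)
    · exact add_le_add (mul_le_of_le_one_left h2.le h1.2)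
        (mul_le_of_le_one_left h3.le (by linarith))
  refine ⟨fun X => ∏ j ∈ Finset.univ.erase i, h j (X i - X j), fun X => ?_, ?_, ?_⟩
  · have := sum_bernoulliProb_mul_prod_of_injOn (edgeProb_symm hFi hFo σ X) (Finset.univ.erase i)
      (fun _ => i) id (fun r hr => (Finset.ne_of_mem_erase hr).symm) (fun r hr r' hr' hrr => by
        rcases edge_eq_iff.1 hrr with h | h
        · exact h.2
        · exact h.2.trans h.1) α β
    refine Eq.trans (Finset.sum_congr rfl fun G _ => ?_) this
    rw [graphProb_eq, deviation, Finset.mul_sum, Real.exp_sum]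
    congr 1
    refine Finset.prod_congr rfl fun j _ => ?_
    simp only [id, hα, hβ, hm]
    split_ifs <;> ring_nf
  · refine Integrable.of_bound (Finset.measurable_prod _ fun j _ => (hmeas j).comp
      ((measurable_pi_apply i).sub (measurable_pi_apply j))).aestronglyMeasurable
      (∏ j ∈ Finset.univ.erase i, (α j + β j)) (ae_of_all _ fun X => ?_)
    rw [Real.norm_eq_abs, Finset.abs_prod]
    refine Finset.prod_le_prod (fun _ _ => abs_nonneg _) fun j _ => ?_
    rw [abs_of_nonneg (hbound _ _).1]
    exact (hbound _ _).2
  · rw [integral_prod_differences i hmeas]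
    have h1 : ∀ j, ∫ x, h j x ∂(unif d) = m j * α j + (1 - m j) * β j := fun j => by
      have hi := integrable_connectivity hFi hFo (σ i) (σ j)
      have hi' : Integrable (fun x => 1 - connectivity Fi Fo x (σ i) (σ j)) (unif d) :=
        (integrable_const 1).sub hi
      rw [hh, integral_add (hi.mul_const _) (hi'.mul_const _),
        integral_mul_const, integral_mul_const, integral_sub (integrable_const 1) hi]
      simp [hm, meanProb]
    have h2 : ∀ j, ∫ x, h j x ∂(unif d) ≤ Real.exp (t ^ 2) := fun j => by
      rw [h1]
      refine (bernoulli_mgf_le (meanProb_mem hFi hFo _ _) ?_).trans (le_of_eq ?_)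
      · rwa [abs_mul, abs_sgn, mul_one]
      · rw [mul_pow, sq (sgn _), sgn_mul_self, mul_one]
    calc _ ≤ ∏ j ∈ Finset.univ.erase i, Real.exp (t ^ 2) :=
          Finset.prod_le_prod (fun j _ => integral_nonneg fun x => (hbound j x).1) fun j _ => h2 j
      _ ≤ _ := by
          rw [← Real.exp_sum, Real.exp_le_exp, Finset.sum_const, nsmul_eq_mul, mul_comm]
          refine mul_le_mul_of_nonneg_left ?_ (sq_nonneg _)
          exact_mod_cast (Finset.card_le_univ _).trans (by simp)

include hFi hFo in
lemma law_deviation_le {n : ℕ} (i : Fin n) {t : ℝ} (ht : |t| ≤ 1) (a : ℝ) :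
    law n Fi Fo {p | 1 ≤ Real.exp (t * deviation Fi Fo p.1.1 p.2 i - a)} ≤
      ENNReal.ofReal (Real.exp (t ^ 2 * n - a)) := by
  choose g h1 h2 h3 using fun σ : Labelling n => exp_deviation_integral_le hFi hFo σ i ht
  refine law_le hFi hFo (f := fun ω G => Real.exp (t * deviation Fi Fo ω.1 G i - a))
    (g := fun σ X => g σ X * Real.exp (-a))
    (fun ω G => (Real.exp_pos _).le) (fun G => ?_) (fun σ _ X => ?_) (fun σ _ => ?_)
    (fun σ _ => ?_)
  · exact (Measurable.of_discrete (f := fun σ : Labelling n =>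
      Real.exp (t * deviation Fi Fo σ G i - a))).comp measurable_fst
  · rw [← h1, Finset.sum_mul]
    refine le_of_eq (Finset.sum_congr rfl fun G _ => ?_)
    rw [sub_eq_add_neg, Real.exp_add]
    ring
  · exact (h2 σ).mul_const _
  · rw [integral_mul_const, sub_eq_add_neg, Real.exp_add]
    exact mul_le_mul_of_nonneg_right (h3 σ) (Real.exp_pos _).le

include hFi hFo in
/-- With high probability all the signed degrees are close to their means. -/
lemma law_exists_deviation_le {n : ℕ} {ε : ℝ} (hε0 : 0 < ε) (hε1 : ε ≤ 1) :
    law n Fi Fo {p | ∃ i, ε * n ≤ |deviation Fi Fo p.1.1 p.2 i|} ≤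
      ENNReal.ofReal (n * (2 * Real.exp (-(ε ^ 2 / 4) * n))) := by
  -- Chernoff's bound at `t = ± ε / 2`, which minimises `t ^ 2 * n - |t| * ε * n`, with value `-(ε ^
  -- 2 / 4) * n`.
  have ht : |ε / 2| ≤ 1 := by rw [abs_of_pos (by linarith)]; linarith
  have ht' : |-(ε / 2)| ≤ 1 := by rwa [abs_neg]
  have key : ∀ i : Fin n, law n Fi Fo {p | ε * n ≤ |deviation Fi Fo p.1.1 p.2 i|} ≤
      ENNReal.ofReal (2 * Real.exp (-(ε ^ 2 / 4) * n)) := fun i => by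
    have h1 := law_deviation_le hFi hFo i ht (ε / 2 * (ε * n))
    have h2 := law_deviation_le hFi hFo i ht' (ε / 2 * (ε * n))
    refine ((measure_mono ?_).trans (measure_union_le _ _)).trans ((add_le_add h1 h2).trans ?_)
    · intro p hp
      simp only [Set.mem_ofPred_eq, Set.mem_union, Real.one_le_exp_iff] at hp ⊢
      rcases le_abs.1 hp with h | h
      · left
        rw [← mul_sub]
        exact mul_nonneg (by linarith) (by linarith)
      · right
        rw [neg_mul_comm, ← mul_sub]
        exact mul_nonneg (by linarith) (by linarith)
    · rw [← ENNReal.ofReal_add (Real.exp_pos _).le (Real.exp_pos _).le]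
      refine ENNReal.ofReal_le_ofReal (le_of_eq ?_)
      ring_nf
  have : {p : (Labelling n × (Fin n → Torus d)) × SimpleGraph (Fin n) |
      ∃ i, ε * n ≤ |deviation Fi Fo p.1.1 p.2 i|} =
      ⋃ i, {p | ε * n ≤ |deviation Fi Fo p.1.1 p.2 i|} := by
    ext p
    simp
  rw [this]
  refine (measure_iUnion_fintype_le _ _).trans ((Finset.sum_le_sum fun i _ => key i).trans ?_)
  rw [Finset.sum_const, Finset.card_univ, Fintype.card_fin, nsmul_eq_mul,
    ENNReal.ofReal_mul (Nat.cast_nonneg n), ENNReal.ofReal_natCast]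

end

/-! ### Almost orthonormal families and approximate eigenvectors -/

section AlmostOrthonormal

variable {E : Type*} [NormedAddCommGroup E] [InnerProductSpace ℂ E] {J : Type*} [Fintype J]
  [DecidableEq J]

/-- A family of vectors whose Gram matrix is entrywise within `η` of the identity. -/
def AlmostOrthonormal (η : ℝ) (φ : J → E) : Prop :=
  ∀ i j, ‖inner ℂ (φ i) (φ j) - (if i = j then 1 else 0)‖ ≤ η

variable {η : ℝ} {φ : J → E}

/-- Off the identity, the Gram matrix contributes at most `η * (∑ ‖b j‖) ^ 2`, which Cauchy–Schwarz
bounds by `η * |J| * ∑ ‖b j‖ ^ 2`. -/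
lemma AlmostOrthonormal.norm_sum_sq_le (h : AlmostOrthonormal η φ)
    (hηJ : η * Fintype.card J ≤ 1) (hη : 0 ≤ η) (b : J → ℂ) :
    ‖∑ j, b j • φ j‖ ^ 2 ≤ 2 * ∑ j, ‖b j‖ ^ 2 := by
  have h1 : ∀ i j, ‖inner ℂ (φ i) (φ j)‖ ≤ (if i = j then 1 else 0) + η := fun i j => by
    have := norm_add_le (inner ℂ (φ i) (φ j) - (if i = j then 1 else 0))
      (if i = j then (1 : ℂ) else 0)
    rw [sub_add_cancel] at this
    have h2 : ‖if i = j then (1 : ℂ) else 0‖ = if i = j then 1 else 0 := by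
      split_ifs <;> simp
    have := h i j
    linarith
  have h2 : ‖∑ j, b j • φ j‖ ^ 2 ≤ ∑ i, ∑ j, ‖b i‖ * ‖b j‖ * ((if i = j then 1 else 0) + η) := by
    have h3 : ‖∑ j, b j • φ j‖ ^ 2 = ‖inner ℂ (∑ j, b j • φ j) (∑ j, b j • φ j)‖ := by
      rw [inner_self_eq_norm_sq_to_K]
      simp
    rw [h3, sum_inner]
    refine (norm_sum_le _ _).trans (Finset.sum_le_sum fun i _ => ?_)
    rw [inner_sum]
    refine (norm_sum_le _ _).trans (Finset.sum_le_sum fun j _ => ?_)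
    rw [inner_smul_left, inner_smul_right, norm_mul, norm_mul, RCLike.norm_conj, ← mul_assoc]
    exact mul_le_mul_of_nonneg_left (h1 i j) (by positivity)
  have h3 : ∑ i, ∑ j, ‖b i‖ * ‖b j‖ * ((if i = j then 1 else 0) + η) =
      ∑ j, ‖b j‖ ^ 2 + η * (∑ j, ‖b j‖) ^ 2 := by
    simp_rw [mul_add, Finset.sum_add_distrib, sq, Finset.sum_mul_sum]
    congr 1
    · simp
    · simp_rw [← Finset.sum_mul]
      rw [mul_comm]
  have h4 : (∑ j, ‖b j‖) ^ 2 ≤ Fintype.card J * ∑ j, ‖b j‖ ^ 2 := by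
    simpa using sq_sum_le_card_mul_sum_sq (s := Finset.univ) (f := fun j => ‖b j‖)
  have h5 : 0 ≤ ∑ j, ‖b j‖ ^ 2 := Finset.sum_nonneg fun _ _ => sq_nonneg _
  calc _ ≤ ∑ j, ‖b j‖ ^ 2 + η * (∑ j, ‖b j‖) ^ 2 := h2.trans h3.le
    _ ≤ ∑ j, ‖b j‖ ^ 2 + η * (Fintype.card J * ∑ j, ‖b j‖ ^ 2) := by gcongr
    _ = ∑ j, ‖b j‖ ^ 2 + (η * Fintype.card J) * ∑ j, ‖b j‖ ^ 2 := by ring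
    _ ≤ ∑ j, ‖b j‖ ^ 2 + 1 * ∑ j, ‖b j‖ ^ 2 := by gcongr
    _ = _ := by ring

/-- Bessel's inequality for almost orthonormal families. -/
lemma AlmostOrthonormal.sum_norm_inner_sq_le (h : AlmostOrthonormal η φ)
    (hηJ : η * Fintype.card J ≤ 1) (hη : 0 ≤ η) (r : E) :
    ∑ j, ‖inner ℂ (φ j) r‖ ^ 2 ≤ 2 * ‖r‖ ^ 2 := by
  set S := ∑ j, ‖inner ℂ (φ j) r‖ ^ 2 with hS
  have hS0 : 0 ≤ S := Finset.sum_nonneg fun _ _ => sq_nonneg _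
  -- Duality: `⟪w, r⟫ = S` while `‖w‖ ^ 2 ≤ 2 * S`, so Cauchy–Schwarz gives `S ^ 2 ≤ 2 * S * ‖r‖ ^
  -- 2`.
  set w := ∑ j, inner ℂ (φ j) r • φ j with hw
  have h1 : ‖w‖ ^ 2 ≤ 2 * S := h.norm_sum_sq_le hηJ hη _
  have h2 : inner ℂ w r = (S : ℂ) := by
    rw [hw, sum_inner, hS, Complex.ofReal_sum]
    refine Finset.sum_congr rfl fun j _ => ?_
    rw [inner_smul_left, Complex.conj_mul']
    simp
  have h3 : S ≤ ‖w‖ * ‖r‖ := by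
    have := norm_inner_le_norm (𝕜 := ℂ) w r
    rwa [h2, Complex.norm_real, Real.norm_of_nonneg hS0] at this
  by_contra! hlt
  have hSpos : 0 < S := lt_of_le_of_lt (by positivity) hlt
  have h4 : S * S ≤ S * (2 * ‖r‖ ^ 2) := by
    calc S * S ≤ (‖w‖ * ‖r‖) * (‖w‖ * ‖r‖) := mul_self_le_mul_self hS0 h3
      _ = ‖w‖ ^ 2 * ‖r‖ ^ 2 := by ring
      _ ≤ (2 * S) * ‖r‖ ^ 2 := by gcongr
      _ = _ := by ring
  exact absurd (le_of_mul_le_mul_left h4 hSpos) (not_le.2 hlt)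

/-- An approximate eigenvector of `∑ c j ⟪φ j, ·⟫ φ j`, for an eigenvalue away from the `c j` with
`j ≠ k`, is almost proportional to `φ k`. -/
lemma AlmostOrthonormal.norm_smul_sub_le (h : AlmostOrthonormal η φ)
    (hηJ : η * Fintype.card J ≤ 1) (hη : 0 ≤ η) {ε γ : ℝ} (hε : 0 ≤ ε) (hγ : 0 < γ)
    (hηε : 8 * η ^ 2 * (Fintype.card J : ℝ) ^ 3 ≤ ε ^ 2)
    {c : J → ℂ} (hc : ∀ j, ‖c j‖ ≤ 1) {v : E} (hv : ‖v‖ ≤ 1) {l : ℂ} {k : J}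
    (hgap : ∀ j, j ≠ k → γ / 2 ≤ ‖l - c j‖)
    (hl : ‖l • v - ∑ j, (c j * inner ℂ (φ j) v) • φ j‖ ≤ ε) :
    ‖l • v - (c k * inner ℂ (φ k) v) • φ k‖ ≤ ε + 7 * ε / γ := by
  set a : J → ℂ := fun j => inner ℂ (φ j) v with ha
  set r := l • v - ∑ j, (c j * a j) • φ j with hr
  set N : ℝ := ((Fintype.card J : ℕ) : ℝ) with hN
  have ha2 : ∀ j, ‖a j‖ ≤ 2 := fun j => by
    have h1 := (Finset.single_le_sum (f := fun j => ‖a j‖ ^ 2) (fun _ _ => sq_nonneg _)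
      (Finset.mem_univ j)).trans (h.sum_norm_inner_sq_le hηJ hη v)
    have h2 : ‖v‖ ^ 2 ≤ 1 := pow_le_one₀ (norm_nonneg _) hv
    have h1 : ‖a j‖ ^ 2 ≤ 2 * ‖v‖ ^ 2 := h1
    nlinarith [norm_nonneg (a j)]
  -- Pairing the residual `r` with `φ j` isolates `(l - c j) * a j`, up to the Gram error, a sum of
  -- `|J|` terms each at most `1 * 2 * η`.
  have hcoef : ∀ j, ‖(l - c j) * a j‖ ≤ 2 * η * N + ‖inner ℂ (φ j) r‖ := fun j => by
    have h1 : (l - c j) * a j = (∑ i, c i * a i * (inner ℂ (φ j) (φ i) - if j = i then 1 else 0)) +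
        inner ℂ (φ j) r := by
      rw [hr, inner_sub_right, inner_smul_right, inner_sum]
      simp_rw [inner_smul_right, mul_sub, Finset.sum_sub_distrib]
      simp [ha]
      ring
    rw [h1]
    refine (norm_add_le _ _).trans (add_le_add_left ((norm_sum_le _ _).trans ?_) _)
    calc _ ≤ ∑ _i : J, 2 * η := Finset.sum_le_sum fun i _ => by
          rw [norm_mul, norm_mul]
          have := mul_le_mul (mul_le_mul (hc i) (ha2 i) (norm_nonneg _) zero_le_one) (h j i)
            (norm_nonneg _) (by norm_num)
          linarith
      _ = _ := by
          rw [Finset.sum_const, Finset.card_univ, nsmul_eq_mul]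
          ring
  have hsum : ∑ j, ‖(l - c j) * a j‖ ^ 2 ≤ 5 * ε ^ 2 := by
    have hB := h.sum_norm_inner_sq_le hηJ hη r
    have hr2 : ‖r‖ ^ 2 ≤ ε ^ 2 := pow_le_pow_left₀ (norm_nonneg _) hl 2
    calc _ ≤ ∑ j, (8 * η ^ 2 * N ^ 2 + 2 * ‖inner ℂ (φ j) r‖ ^ 2) :=
          Finset.sum_le_sum fun j _ => by
            have := pow_le_pow_left₀ (norm_nonneg _) (hcoef j) 2
            nlinarith [sq_nonneg (2 * η * N - ‖inner ℂ (φ j) r‖)]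
      _ = 8 * η ^ 2 * N ^ 3 + 2 * ∑ j, ‖inner ℂ (φ j) r‖ ^ 2 := by
          rw [Finset.sum_add_distrib, Finset.sum_const, Finset.card_univ, nsmul_eq_mul,
            Finset.mul_sum]
          ring
      _ ≤ _ := by linarith
  -- The gap `γ / 2` turns the bound `5 ε ^ 2` into `5 ε ^ 2 * 4 / γ ^ 2`. Recombining the
  -- components `j ≠ k` costs a further factor 2, and `40 ≤ 7 ^ 2` explains the constant 7.
  have hoff : ∑ j ∈ Finset.univ.erase k, ‖a j‖ ^ 2 ≤ 20 * ε ^ 2 / γ ^ 2 := by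
    rw [le_div_iff₀ (by positivity), Finset.sum_mul]
    have : ∑ j ∈ Finset.univ.erase k, ‖a j‖ ^ 2 * γ ^ 2 ≤
        ∑ j ∈ Finset.univ.erase k, 4 * ‖(l - c j) * a j‖ ^ 2 := by
      refine Finset.sum_le_sum fun j hj => ?_
      have h1 := pow_le_pow_left₀ (by positivity) (hgap j (Finset.ne_of_mem_erase hj)) 2
      rw [norm_mul, mul_pow]
      nlinarith [mul_le_mul_of_nonneg_right h1 (sq_nonneg ‖a j‖)]
    rw [← Finset.mul_sum] at this
    have h2 : ∑ j ∈ Finset.univ.erase k, ‖(l - c j) * a j‖ ^ 2 ≤ ∑ j, ‖(l - c j) * a j‖ ^ 2 :=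
      Finset.sum_le_sum_of_subset_of_nonneg (Finset.erase_subset _ _)
        fun _ _ _ => sq_nonneg _
    linarith
  set w := ∑ j ∈ Finset.univ.erase k, (c j * a j) • φ j with hw
  have hw2 : ‖w‖ ^ 2 ≤ (7 * ε / γ) ^ 2 := by
    have h1 : w = ∑ j, (if j = k then 0 else c j * a j) • φ j := by
      rw [hw, ← Finset.add_sum_erase _ _ (Finset.mem_univ k)]
      simp only [if_true, zero_smul, zero_add]
      exact Finset.sum_congr rfl fun j hj => by rw [if_neg (Finset.ne_of_mem_erase hj)]
    have h2 : ∑ j, ‖if j = k then 0 else c j * a j‖ ^ 2 ≤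
        ∑ j ∈ Finset.univ.erase k, ‖a j‖ ^ 2 := by
      rw [← Finset.add_sum_erase _ _ (Finset.mem_univ k)]
      simp only [if_true, norm_zero, zero_pow two_ne_zero, zero_add]
      refine Finset.sum_le_sum fun j hj => ?_
      rw [if_neg (Finset.ne_of_mem_erase hj), norm_mul]
      exact pow_le_pow_left₀ (by positivity)
        (mul_le_of_le_one_left (norm_nonneg _) (hc j)) 2
    have h3 := h.norm_sum_sq_le hηJ hη fun j => if j = k then 0 else c j * a j
    rw [← h1] at h3
    have h4 : (7 * ε / γ) ^ 2 = 49 / 20 * (20 * ε ^ 2 / γ ^ 2) := by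
      field_simp
      ring
    rw [h4]
    have : 0 ≤ 20 * ε ^ 2 / γ ^ 2 := by positivity
    linarith
  have hw3 : ‖w‖ ≤ 7 * ε / γ := le_of_sq_le_sq hw2 (by positivity)
  have heq : l • v - (c k * a k) • φ k = r + w := by
    rw [hr, ← Finset.add_sum_erase _ _ (Finset.mem_univ k), ← hw]
    abel
  rw [heq]
  exact (norm_add_le _ _).trans (add_le_add hl hw3)

end AlmostOrthonormal

/-! ### From an approximate eigenvector to exact recovery -/

/-- If a sign vector is an approximate eigenvector of a symmetric matrix, then some eigenvalue is
close to the approximate one. -/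
lemma exists_eigenvalue_near {n : ℕ} (hn : 0 < n) {A : Matrix (Fin n) (Fin n) ℝ}
    (hA : A.IsHermitian) {s : Fin n → ℝ} (hs : ∀ i, |s i| = 1) {l δ : ℝ} (hδ : 0 ≤ δ)
    (h : ∀ i, |∑ j, A i j * s j - l * s i| ≤ δ) :
    ∃ l', Module.End.HasEigenvalue (Matrix.toLin' A) l' ∧ |l' - l| ≤ δ := by
  -- If every eigenvalue were further than `δ` from `l`, expanding in an eigenbasis would give `‖A s
  -- - l s‖ ^ 2 > δ ^ 2 * ‖s‖ ^ 2 = n * δ ^ 2`, against the coordinatewise bound.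
  by_contra! hcon
  set b := hA.eigenvectorBasis with hb
  set u : EuclideanSpace ℝ (Fin n) := WithLp.toLp 2 s with hu
  have heig : ∀ k, δ < |hA.eigenvalues k - l| := fun k => by
    refine hcon _ (Module.End.hasEigenvalue_of_hasEigenvector
      (x := WithLp.ofLp (b k)) ⟨?_, ?_⟩)
    · rw [Module.End.mem_eigenspace_iff, Matrix.toLin'_apply]
      exact hA.mulVec_eigenvectorBasis k
    · intro h0
      have := b.orthonormal.ne_zero k
      apply this
      ext i
      exact congrFun h0 i
  set z : EuclideanSpace ℝ (Fin n) := WithLp.toLp 2 (A.mulVec s - l • s) with hz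
  have hnorm : ∑ k, (inner ℝ (b k) u) ^ 2 = n := by
    have h1 := b.sum_sq_norm_inner_right u
    simp only [Real.norm_eq_abs, sq_abs] at h1
    rw [h1, EuclideanSpace.norm_sq_eq]
    simp [hu, hs]
  have hznorm : ∑ k, (inner ℝ (b k) z) ^ 2 ≤ n * δ ^ 2 := by
    have h1 := b.sum_sq_norm_inner_right z
    simp only [Real.norm_eq_abs, sq_abs] at h1
    rw [h1, EuclideanSpace.norm_sq_eq]
    calc _ ≤ ∑ _i : Fin n, δ ^ 2 := Finset.sum_le_sum fun i _ => by
          refine pow_le_pow_left₀ (norm_nonneg _) ?_ 2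
          exact h i
      _ = _ := by simp
  have hzk : ∀ k, inner ℝ (b k) z = (hA.eigenvalues k - l) * inner ℝ (b k) u := fun k => by
    have h1 : inner ℝ (b k) (WithLp.toLp 2 (A.mulVec s)) =
        hA.eigenvalues k * inner ℝ (b k) u := by
      rw [EuclideanSpace.inner_eq_star_dotProduct, EuclideanSpace.inner_eq_star_dotProduct]
      simp only [star_trivial, hu]
      rw [dotProduct_comm, Matrix.dotProduct_mulVec, ← Matrix.mulVec_transpose]
      have hT : A.transpose = A := by
        rw [← Matrix.conjTranspose_eq_transpose_of_trivial]
        exact hA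
      rw [hT, hA.mulVec_eigenvectorBasis k, smul_dotProduct, dotProduct_comm]
      rfl
    have h2 : z = WithLp.toLp 2 (A.mulVec s) - l • u := rfl
    rw [h2, inner_sub_right, h1, inner_smul_right]
    ring
  have hlt : ∑ k, δ ^ 2 * (inner ℝ (b k) u) ^ 2 < ∑ k, (inner ℝ (b k) z) ^ 2 := by
    have hle : ∀ k, δ ^ 2 < (hA.eigenvalues k - l) ^ 2 := fun k => by
      rw [← sq_abs (_ - _)]
      exact pow_lt_pow_left₀ (heig k) hδ two_ne_zero
    have hpos : ∃ k, 0 < (inner ℝ (b k) u) ^ 2 := by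
      by_contra! h0
      have : ∑ k, (inner ℝ (b k) u) ^ 2 ≤ 0 := Finset.sum_nonpos fun k _ => h0 k
      rw [hnorm] at this
      have : (0 : ℝ) < n := by exact_mod_cast hn
      linarith
    obtain ⟨k, hk⟩ := hpos
    refine Finset.sum_lt_sum (fun k _ => ?_) ⟨k, Finset.mem_univ _, ?_⟩
    · rw [hzk, mul_pow]
      exact mul_le_mul_of_nonneg_right (hle k).le (sq_nonneg _)
    · rw [hzk, mul_pow]
      exact mul_lt_mul_of_pos_right (hle k) hk
  rw [← Finset.mul_sum, hnorm] at hlt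
  linarith

open Classical in
/-- Signs of a vector that is close to a multiple of a sign vector. -/
lemma card_sign_ne_le {n : ℕ} {v s : Fin n → ℝ} (hs : ∀ i, |s i| = 1) {τ : Labelling n}
    (hτ : ∀ i, τ i = if 0 < v i then 0 else 1) {l κ e : ℝ}
    (h : ∑ i, (l * v i - κ * s i) ^ 2 ≤ e) :
    ∃ w : ℝ, |w| = 1 ∧ (Finset.card {i | sgn (τ i) ≠ w * s i} : ℝ) * κ ^ 2 ≤ e := by
  obtain ⟨w, hw, hwl⟩ : ∃ w : ℝ, |w| = 1 ∧ w * (l * κ) = |l * κ| := by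
    rcases le_total 0 (l * κ) with h0 | h0
    · exact ⟨1, by simp, by rw [one_mul, abs_of_nonneg h0]⟩
    · exact ⟨-1, by simp, by rw [abs_of_nonpos h0]; ring⟩
  refine ⟨w, hw, ?_⟩
  have hw2 : w * w = 1 := by rw [← abs_mul_abs_self, hw, one_mul]
  -- With `w` the sign of `l * κ`, an error at `i` means that `l * v i` and `κ * s i` do not have
  -- the same strict sign, so their distance is at least `|κ|`.
  have key : ∀ i, sgn (τ i) ≠ w * s i → κ ^ 2 ≤ (l * v i - κ * s i) ^ 2 := fun i hi => by
    have hs2 : s i * s i = 1 := by rw [← abs_mul_abs_self, hs, one_mul]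
    have h1 : sgn (τ i) = -(w * s i) := by
      have h2 : |sgn (τ i)| = |w * s i| := by rw [abs_sgn, abs_mul, hw, hs, one_mul]
      exact (abs_eq_abs.1 h2).resolve_left hi
    have h3 : w * s i * v i ≤ 0 := by
      rw [hτ i] at h1
      split_ifs at h1 with hv
      · have : w * s i = -1 := by simp [sgn] at h1; linarith
        rw [this]
        linarith
      · have : w * s i = 1 := by simp [sgn] at h1; linarith
        rw [this]
        linarith
    have h4 : (l * κ) * (s i * v i) ≤ 0 := by
      have : (l * κ) * (s i * v i) = (w * (l * κ)) * (w * s i * v i) := by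
        linear_combination (-(l * κ * s i * v i)) * hw2
      rw [this, hwl]
      exact mul_nonpos_of_nonneg_of_nonpos (abs_nonneg _) h3
    have h5 : (l * v i - κ * s i) ^ 2 =
        (l * v i) ^ 2 - 2 * ((l * κ) * (s i * v i)) + κ ^ 2 := by
      linear_combination κ ^ 2 * hs2
    rw [h5]
    nlinarith [sq_nonneg (l * v i)]
  calc _ = ∑ i with sgn (τ i) ≠ w * s i, κ ^ 2 := by
        rw [Finset.sum_const, nsmul_eq_mul]
    _ ≤ ∑ i with sgn (τ i) ≠ w * s i, (l * v i - κ * s i) ^ 2 :=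
        Finset.sum_le_sum fun i hi => key i (Finset.mem_filter.1 hi).2
    _ ≤ ∑ i, (l * v i - κ * s i) ^ 2 :=
        Finset.sum_le_sum_of_subset_of_nonneg (Finset.filter_subset _ _)
          fun _ _ _ => sq_nonneg _
    _ ≤ e := h

lemma sgn_injective : Function.Injective sgn := by
  intro s t h
  fin_cases s <;> fin_cases t <;> simp [sgn] at h ⊢ <;> norm_num at h

lemma loss_eq_zero_of_sgn {n : ℕ} {σ τ : Labelling n} {w : ℝ} (hw : |w| = 1)
    (h : ∀ i, sgn (τ i) = w * sgn (σ i)) : loss σ τ = 0 := by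
  classical
  obtain ⟨π, hπ⟩ : ∃ π : Equiv.Perm (Fin 2), ∀ i, σ i = π (τ i) := by
    rcases (abs_eq zero_le_one).1 hw with rfl | rfl
    · refine ⟨1, fun i => sgn_injective ?_⟩
      rw [Equiv.Perm.one_apply, h i, one_mul]
    · refine ⟨Equiv.swap 0 1, fun i => sgn_injective ?_⟩
      have h1 : ∀ t : Fin 2, sgn (Equiv.swap 0 1 t) = -sgn t := by
        intro t
        fin_cases t <;> simp [sgn]
      rw [h1, h i]
      ring
  have : (⨅ π : Equiv.Perm (Fin 2), Finset.card {i | σ i ≠ π (τ i)} : ℕ) = 0 := by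
    refine Nat.le_zero.1 ((ciInf_le' _ π).trans (le_of_eq ?_))
    rw [Finset.card_eq_zero, Finset.filter_eq_empty_iff]
    exact fun i _ hi => hi (hπ i)
  rw [loss, this]
  simp

open Classical in
lemma neighbourCount_sub {n : ℕ} (G : SimpleGraph (Fin n)) (τ : Labelling n) (i : Fin n) :
    (neighbourCount G τ i 0 : ℝ) - neighbourCount G τ i 1 =
      ∑ j, G.adjMatrix ℝ i j * sgn (τ j) := by
  have h1 : ∀ k, (neighbourCount G τ i k : ℝ) =
      ∑ j, if j ≠ i ∧ τ j = k ∧ G.Adj i j then 1 else 0 := fun k => by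
    rw [Finset.sum_boole, neighbourCount]
  rw [h1, h1, ← Finset.sum_sub_distrib]
  refine Finset.sum_congr rfl fun j _ => ?_
  rw [SimpleGraph.adjMatrix_apply]
  by_cases h : G.Adj i j
  · have hne := h.ne.symm
    generalize τ j = t
    fin_cases t <;> simp [h, hne, sgn]
  · simp [h]

open Classical in
/-- Local improvement corrects a labelling with few errors. -/
lemma loss_eq_zero_of_majority {n : ℕ} (hn : 0 < n) {G : SimpleGraph (Fin n)}
    {σ τ₀ τ : Labelling n} {L ε δ w : ℝ} (hw : |w| = 1) (hL : 2 * δ + ε < |L|)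
    (hG : ∀ i, |∑ j, G.adjMatrix ℝ i j * sgn (σ j) - L * n * sgn (σ i)| ≤ ε * n)
    (hcard : (Finset.card {i | sgn (τ₀ i) ≠ w * sgn (σ i)} : ℝ) ≤ δ * n)
    (hτ : ∀ i k, neighbourCount G τ₀ i k ≤ neighbourCount G τ₀ i (τ i)) :
    loss σ τ = 0 := by
  have hn' : (0 : ℝ) < n := by exact_mod_cast hn
  have hL0 : L ≠ 0 := by
    rintro rfl
    have h1 : (0 : ℝ) ≤ ε * n := (abs_nonneg _).trans (hG ⟨0, hn⟩)
    have h2 : 0 ≤ δ * n := le_trans (Nat.cast_nonneg _) hcard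
    rw [abs_zero] at hL
    nlinarith
  have hS : ∀ i, |∑ j, G.adjMatrix ℝ i j * sgn (τ₀ j) - w * (L * n * sgn (σ i))| ≤
      (2 * δ + ε) * n := fun i => by
    have h1 : |∑ j, G.adjMatrix ℝ i j * sgn (τ₀ j) -
        w * ∑ j, G.adjMatrix ℝ i j * sgn (σ j)| ≤ 2 * (δ * n) := by
      calc _ = |∑ j, G.adjMatrix ℝ i j * (sgn (τ₀ j) - w * sgn (σ j))| := by
            rw [Finset.mul_sum, ← Finset.sum_sub_distrib]
            congr 1
            exact Finset.sum_congr rfl fun j _ => by ring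
        _ ≤ ∑ j, (if sgn (τ₀ j) ≠ w * sgn (σ j) then 2 else 0) := by
            refine (Finset.abs_sum_le_sum_abs _ _).trans (Finset.sum_le_sum fun j _ => ?_)
            rw [abs_mul]
            have hA : |G.adjMatrix ℝ i j| ≤ 1 := by
              rw [SimpleGraph.adjMatrix_apply]
              split_ifs <;> simp
            split_ifs with hj
            · have h2 : |sgn (τ₀ j) - w * sgn (σ j)| ≤ 2 := by
                refine (abs_sub _ _).trans ?_
                rw [abs_sgn, abs_mul, hw, abs_sgn]
                norm_num
              nlinarith [abs_nonneg (G.adjMatrix ℝ i j),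
                abs_nonneg (sgn (τ₀ j) - w * sgn (σ j))]
            · rw [not_not] at hj
              rw [hj, sub_self, abs_zero, mul_zero]
        _ = 2 * (Finset.card {i | sgn (τ₀ i) ≠ w * sgn (σ i)} : ℝ) := by
            rw [← Finset.sum_filter, Finset.sum_const, nsmul_eq_mul, mul_comm]
        _ ≤ _ := by linarith
    have h2 : |w * ∑ j, G.adjMatrix ℝ i j * sgn (σ j) - w * (L * n * sgn (σ i))| ≤ ε * n := by
      rw [← mul_sub, abs_mul, hw, one_mul]
      exact hG i
    have h3 := abs_sub_le (∑ j, G.adjMatrix ℝ i j * sgn (τ₀ j))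
      (w * ∑ j, G.adjMatrix ℝ i j * sgn (σ j)) (w * (L * n * sgn (σ i)))
    linarith
  have hpos : ∀ i, 0 ≤ sgn (τ i) * ∑ j, G.adjMatrix ℝ i j * sgn (τ₀ j) := fun i => by
    rw [← neighbourCount_sub]
    have h0 := hτ i 0
    have h1 := hτ i 1
    generalize τ i = t at h0 h1
    have h0' : (neighbourCount G τ₀ i 0 : ℝ) ≤ neighbourCount G τ₀ i t := by exact_mod_cast h0
    have h1' : (neighbourCount G τ₀ i 1 : ℝ) ≤ neighbourCount G τ₀ i t := by exact_mod_cast h1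
    fin_cases t <;> simp [sgn] at h0' h1' ⊢ <;> linarith
  -- The vote recovers `σ` up to the sign `w * sign L`: for `L < 0` a node has more neighbours in
  -- the opposite community and all labels are swapped.
  have hw' : |w * (L / |L|)| = 1 := by
    rw [abs_mul, hw, abs_div, abs_abs, one_mul, div_self (abs_ne_zero.2 hL0)]
  refine loss_eq_zero_of_sgn hw' fun i => ?_
  by_contra hne
  have h1 : sgn (τ i) = -(w * (L / |L|) * sgn (σ i)) := by
    refine (abs_eq_abs.1 ?_).resolve_left hne
    rw [abs_sgn, abs_mul, hw', abs_sgn, one_mul]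
  have h2 : sgn (τ i) * (w * (L * n * sgn (σ i))) = -(|L| * n) := by
    have hw2 : w * w = 1 := by rw [← abs_mul_abs_self, hw, one_mul]
    have hLL : L / |L| * L = |L| := by
      rw [div_mul_eq_mul_div, div_eq_iff (abs_ne_zero.2 hL0), abs_mul_abs_self]
    rw [h1]
    calc _ = -((w * w) * (L / |L| * L) * n * (sgn (σ i) * sgn (σ i))) := by ring
      _ = _ := by rw [hw2, hLL, sgn_mul_self]; ring
  have h3 : |sgn (τ i) * ∑ j, G.adjMatrix ℝ i j * sgn (τ₀ j) -
      sgn (τ i) * (w * (L * n * sgn (σ i)))| ≤ (2 * δ + ε) * n := by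
    rw [← mul_sub, abs_mul, abs_sgn, one_mul]
    exact hS i
  rw [h2] at h3
  have h4 := (abs_le.1 h3).2
  have h5 := hpos i
  nlinarith

open Classical in
/-- On the good event, the algorithm recovers the labelling exactly. -/
lemma loss_eq_zero_of_good {n : ℕ} (hn : 0 < n) {G : SimpleGraph (Fin n)} {σ τ : Labelling n}
    {μin μout L : ℝ} (hLμ : L = (μin - μout) / 2) (hL0 : L ≠ 0)
    (hτ : IsHOSCLIOutput μin μout G τ)
    {J : Type*} [Fintype J] [DecidableEq J] {φ : J → EuclideanSpace ℂ (Fin n)} {c : J → ℂ}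
    {k : J} {ε γ η : ℝ} (hε : 0 ≤ ε) (hγ : 0 < γ) (hη : 0 ≤ η)
    (hηJ : η * Fintype.card J ≤ 1) (hηε : 8 * η ^ 2 * (Fintype.card J : ℝ) ^ 3 ≤ ε ^ 2)
    (hφk : ∀ i, φ k i = ((sgn (σ i) / √n : ℝ) : ℂ)) (hck : c k = L)
    (hc : ∀ j, ‖c j‖ ≤ 1) (hgap : ∀ j, j ≠ k → γ ≤ ‖c j - L‖) (hεγ : ε ≤ γ / 2)
    (hεL : ε + 7 * ε / γ ≤ L ^ 2 / 8)
    (hG : ∀ i, |∑ j, G.adjMatrix ℝ i j * sgn (σ j) - L * n * sgn (σ i)| ≤ ε * n)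
    (hφ : AlmostOrthonormal η φ)
    (hop : ∀ v : Fin n → ℝ,
      ‖(WithLp.toLp 2 fun i => (((∑ j, G.adjMatrix ℝ i j * v j) / n : ℝ) : ℂ) :
          EuclideanSpace ℂ (Fin n)) -
        ∑ j, (c j * inner ℂ (φ j) (WithLp.toLp 2 fun i => (v i : ℂ))) • φ j‖ ^ 2 ≤
      ε ^ 2 * ∑ i, v i ^ 2) :
    loss σ τ = 0 := by
  have hn' : (0 : ℝ) < n := by exact_mod_cast hn
  obtain ⟨τ₀, ⟨lam, v₀, hv₀, hclose, hτ₀⟩, hmaj⟩ := hτ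
  have hL1 : |L| ≤ 1 := by simpa [hck] using hc k
  have hLpos : 0 < |L| := abs_pos.2 hL0
  have hL2 : L ^ 2 ≤ |L| := by
    rw [← sq_abs]
    nlinarith
  have h7 : 0 ≤ 7 * ε / γ := by positivity
  -- the eigenvalue is close to `L * n`
  have hlam : |lam / n - L| ≤ ε := by
    obtain ⟨l', hl', hl'2⟩ := exists_eigenvalue_near hn (A := G.adjMatrix ℝ)
      (by simp) (s := fun i => sgn (σ i))
      (fun i => abs_sgn _) (mul_nonneg hε hn'.le) hG
    have h1 := hclose l' hl'
    rw [← hLμ] at h1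
    have h2 : lam / n - L = (lam - L * n) / n := by field_simp
    rw [h2, abs_div, abs_of_pos hn', div_le_iff₀ hn']
    exact h1.trans hl'2
  -- normalise the eigenvector
  set N : ℝ := √(∑ i, v₀ i ^ 2) with hN
  have hv₀ne : 0 < ∑ i, v₀ i ^ 2 := by
    obtain ⟨i, hi⟩ := Function.ne_iff.1 hv₀.2
    have hi' : v₀ i ≠ 0 := hi
    exact lt_of_lt_of_le (by positivity) (Finset.single_le_sum (f := fun i => v₀ i ^ 2)
      (fun _ _ => sq_nonneg _) (Finset.mem_univ i))
  have hNpos : 0 < N := Real.sqrt_pos.2 hv₀ne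
  set v : Fin n → ℝ := fun i => v₀ i / N with hv
  have hvnorm : ∑ i, v i ^ 2 = 1 := by
    simp only [hv, div_pow]
    rw [← Finset.sum_div, hN, Real.sq_sqrt hv₀ne.le, div_self hv₀ne.ne']
  have hveig : ∀ i, ∑ j, G.adjMatrix ℝ i j * v j = lam * v i := fun i => by
    have h1 := congrFun hv₀.apply_eq_smul i
    rw [Matrix.toLin'_apply] at h1
    simp only [Matrix.mulVec, dotProduct, Pi.smul_apply, smul_eq_mul] at h1
    simp only [hv, mul_div_assoc']
    rw [← Finset.sum_div, h1]
  have hτv : ∀ i, τ₀ i = if 0 < v i then 0 else 1 := fun i => by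
    rw [hτ₀ i]
    simp only [hv, div_pos_iff_of_pos_right hNpos]
  set vc : EuclideanSpace ℂ (Fin n) := WithLp.toLp 2 fun i => (v i : ℂ) with hvc
  have hvcnorm : ‖vc‖ ^ 2 = 1 := by
    rw [EuclideanSpace.norm_sq_eq]
    simpa [hvc] using hvnorm
  have hvc1 : ‖vc‖ ≤ 1 := le_of_sq_le_sq (by rw [hvcnorm, one_pow]) zero_le_one
  have hAv : (WithLp.toLp 2 fun i => (((∑ j, G.adjMatrix ℝ i j * v j) / n : ℝ) : ℂ) :
      EuclideanSpace ℂ (Fin n)) = ((lam / n : ℝ) : ℂ) • vc := by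
    ext i
    simp only [hveig, hvc, PiLp.smul_apply, smul_eq_mul]
    push_cast
    ring
  have happrox := hop v
  rw [hAv, hvnorm, mul_one] at happrox
  have hmain := hφ.norm_smul_sub_le hηJ hη hε hγ hηε hc hvc1 (l := ((lam / n : ℝ) : ℂ)) (k := k)
    (fun j hj => by
      have h1 := hgap j hj
      have h2 : ‖((lam / n : ℝ) : ℂ) - L‖ ≤ ε := by
        rw [← Complex.ofReal_sub, Complex.norm_real]
        exact hlam
      have h3 := norm_sub_le_norm_sub_add_norm_sub (c j) ((lam / n : ℝ) : ℂ) (L : ℂ)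
      rw [norm_sub_rev (c j) ((lam / n : ℝ) : ℂ)] at h3
      linarith)
    (le_of_sq_le_sq happrox hε)
  -- the inner product with `φ k` is real
  set a : ℝ := ∑ i, sgn (σ i) / √n * v i with ha
  have hinner : inner ℂ (φ k) vc = (a : ℂ) := by
    rw [PiLp.inner_apply, ha, Complex.ofReal_sum]
    refine Finset.sum_congr rfl fun i _ => ?_
    rw [hφk, RCLike.inner_apply, Complex.conj_ofReal, ← Complex.ofReal_mul, mul_comm]
  set κ : ℝ := L * a / √n with hκ
  have hcoord : ∑ i, (lam / n * v i - κ * sgn (σ i)) ^ 2 ≤ (L ^ 2 / 8) ^ 2 := by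
    have h1 : ‖((lam / n : ℝ) : ℂ) • vc - (c k * inner ℂ (φ k) vc) • φ k‖ ^ 2 =
        ∑ i, (lam / n * v i - κ * sgn (σ i)) ^ 2 := by
      rw [EuclideanSpace.norm_sq_eq]
      refine Finset.sum_congr rfl fun i _ => ?_
      have h2 : (((lam / n : ℝ) : ℂ) • vc - (c k * inner ℂ (φ k) vc) • φ k) i =
          ((lam / n * v i - κ * sgn (σ i) : ℝ) : ℂ) := by
        rw [PiLp.sub_apply, PiLp.smul_apply, PiLp.smul_apply, hφk, hinner, hck, hκ]
        simp only [hvc, smul_eq_mul]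
        push_cast
        ring
      rw [h2, Complex.norm_real, Real.norm_eq_abs, sq_abs]
    rw [← h1]
    exact pow_le_pow_left₀ (norm_nonneg _) (hmain.trans hεL) 2
  -- The multiple of `σ` cannot be small, as `(lam / n) • v` has norm close to `|L|`: `49 / 64 * L ^
  -- 2 ≤ (lam / n) ^ 2 ≤ 2 * (L ^ 2 / 8) ^ 2 + 2 * n * κ ^ 2`.
  have hκ2 : L ^ 2 / (4 * n) ≤ κ ^ 2 := by
    have h1 : ∑ i, (κ * sgn (σ i)) ^ 2 = n * κ ^ 2 := by
      simp_rw [mul_pow, sq (sgn _), sgn_mul_self]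
      simp
    have h2 : ∑ i, (lam / n * v i) ^ 2 = (lam / n) ^ 2 := by
      simp_rw [mul_pow]
      rw [← Finset.mul_sum, hvnorm, mul_one]
    have h3 : ∑ i, (lam / n * v i) ^ 2 ≤
        ∑ i, (2 * (lam / n * v i - κ * sgn (σ i)) ^ 2 + 2 * (κ * sgn (σ i)) ^ 2) :=
      Finset.sum_le_sum fun i _ => by
        nlinarith [sq_nonneg (lam / n * v i - κ * sgn (σ i) - κ * sgn (σ i))]
    rw [Finset.sum_add_distrib, ← Finset.mul_sum, ← Finset.mul_sum, h1, h2] at h3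
    have h4 : 7 / 8 * |L| ≤ |lam / n| := by
      have := abs_sub_abs_le_abs_sub L (lam / n)
      rw [abs_sub_comm] at this
      linarith
    have h5 : 49 / 64 * L ^ 2 ≤ (lam / n) ^ 2 := by
      rw [← sq_abs L, ← sq_abs (lam / n)]
      nlinarith
    have h6 : (L ^ 2 / 8) ^ 2 ≤ L ^ 2 / 64 := by nlinarith [sq_nonneg L]
    have h7 : κ ^ 2 * (4 * n) = 4 * (n * κ ^ 2) := by ring
    rw [div_le_iff₀ (by positivity), h7]
    linarith [sq_nonneg L]
  obtain ⟨w, hw, hcard⟩ := card_sign_ne_le (s := fun i => sgn (σ i)) (fun i => abs_sgn _) hτv hcoord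
  -- The error count times `L ^ 2 / (4 * n)` is at most `L ^ 4 / 64`, whence `δ = L ^ 2 / 16`. The
  -- vote needs `2 * δ + ε < |L|`, and here `2 * δ + ε ≤ L ^ 2 / 4`.
  refine loss_eq_zero_of_majority hn hw (δ := L ^ 2 / 16) (ε := ε) ?_ hG ?_ hmaj
  · linarith
  · have h1 := (mul_le_mul_of_nonneg_left hκ2 (Nat.cast_nonneg
      (Finset.card {i | sgn (τ₀ i) ≠ w * sgn (σ i)}))).trans hcard
    rw [mul_div_assoc', div_le_iff₀ (by positivity)] at h1
    have h2 : 0 < L ^ 2 := by positivity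
    refine le_of_mul_le_mul_right (h1.trans (le_of_eq ?_)) h2
    ring

/-! ### Fourier analysis of the connectivity functions -/

lemma fourier_eq_integral {d : ℕ} (F : Torus d → ℝ) (k : Fin d → ℤ) :
    fourier F k = ∫ x, UnitAddTorus.mFourier (-k) x * (F x : ℂ) ∂unif d := rfl

lemma norm_mFourier_apply {d : ℕ} (k : Fin d → ℤ) (x : Torus d) :
    ‖UnitAddTorus.mFourier k x‖ = 1 := by
  simp only [UnitAddTorus.mFourier, ContinuousMap.coe_mk, norm_prod, fourier_apply,
    Circle.norm_coe, Finset.prod_const_one]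

lemma mFourier_sub {d : ℕ} (k : Fin d → ℤ) (x y : Torus d) :
    UnitAddTorus.mFourier k (x - y) =
      UnitAddTorus.mFourier k x * starRingEnd ℂ (UnitAddTorus.mFourier k y) := by
  rw [← UnitAddTorus.mFourier_neg]
  simp [UnitAddTorus.mFourier, ← Finset.prod_mul_distrib, sub_eq_add_neg, smul_add,
    AddCircle.toCircle_add]

section

variable {d : ℕ} {F : Torus d → ℝ} (hF : IsConnectivityFunction F)

include hF

lemma IsConnectivityFunction.memLp : MemLp (fun x => (F x : ℂ)) 2 (unif d) := by
  refine MemLp.of_bound (Complex.measurable_ofReal.comp hF.measurable).aestronglyMeasurable 1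
    (ae_of_all _ fun x => ?_)
  rw [Complex.norm_real, Real.norm_of_nonneg (hF.mem_unit x).1]
  exact (hF.mem_unit x).2

lemma mFourierCoeff_toLp (k : Fin d → ℤ) :
    UnitAddTorus.mFourierCoeff (hF.memLp.toLp _) k = fourier F k := by
  refine integral_congr_ae ?_
  filter_upwards [hF.memLp.coeFn_toLp] with x hx
  rw [hx]

lemma norm_fourier_le (k : Fin d → ℤ) : ‖fourier F k‖ ≤ 1 := by
  rw [fourier_eq_integral]
  refine (norm_integral_le_of_norm_le_const (C := 1) (ae_of_all _ fun x => ?_)).trans ?_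
  · rw [norm_mul, norm_mFourier_apply, one_mul, Complex.norm_real,
      Real.norm_of_nonneg (hF.mem_unit x).1]
    exact (hF.mem_unit x).2
  · simp

/-- By Parseval the squared coefficients are summable. -/
lemma tendsto_fourier : Tendsto (fourier F) cofinite (𝓝 0) := by
  have h1 := (UnitAddTorus.hasSum_sq_mFourierCoeff (hF.memLp.toLp _)).summable
  simp_rw [mFourierCoeff_toLp hF] at h1
  have h2 := (Real.continuous_sqrt.tendsto _).comp h1.tendsto_cofinite_zero
  simp only [Real.sqrt_zero, Function.comp_def, Real.sqrt_sq (norm_nonneg _)] at h2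
  exact tendsto_zero_iff_norm_tendsto_zero.2 h2

/-- The Fourier series converges in mean square. -/
lemma exists_integral_sub_sum_sq_le {δ : ℝ} (hδ : 0 < δ) :
    ∃ K₀ : Finset (Fin d → ℤ), ∀ K, K₀ ⊆ K →
      ∫ x, ‖(F x : ℂ) - ∑ k ∈ K, fourier F k * UnitAddTorus.mFourier k x‖ ^ 2 ∂unif d ≤ δ := by
  have h1 := UnitAddTorus.hasSum_mFourier_series_L2 (hF.memLp.toLp _)
  simp_rw [mFourierCoeff_toLp hF] at h1
  obtain ⟨K₀, hK₀⟩ := (Metric.tendsto_atTop.1 h1) (√δ) (Real.sqrt_pos.2 hδ)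
  refine ⟨K₀, fun K hK => ?_⟩
  have h2 := hK₀ K hK
  set S : Lp ℂ 2 (unif d) := ∑ k ∈ K, fourier F k • UnitAddTorus.mFourierLp 2 k with hS
  have h3 : ‖hF.memLp.toLp _ - S‖ < √δ := by
    rw [← dist_eq_norm, dist_comm]
    exact h2
  have h4 : ‖hF.memLp.toLp _ - S‖ ^ 2 =
      ∫ x, ‖(F x : ℂ) - ∑ k ∈ K, fourier F k * UnitAddTorus.mFourier k x‖ ^ 2 ∂unif d := by
    have h5 : S = ContinuousMap.toLp (E := ℂ) 2 (unif d) ℂ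
        (∑ k ∈ K, fourier F k • UnitAddTorus.mFourier k) := by
      rw [hS, map_sum]
      exact Finset.sum_congr rfl fun k _ => (map_smul _ _ _).symm
    have h6 : ∀ᵐ x ∂unif d, (hF.memLp.toLp _ - S : Lp ℂ 2 (unif d)) x =
        (F x : ℂ) - ∑ k ∈ K, fourier F k * UnitAddTorus.mFourier k x := by
      have h7 := ContinuousMap.coeFn_toLp (p := 2) (𝕜 := ℂ) (unif d)
        (∑ k ∈ K, fourier F k • UnitAddTorus.mFourier k)
      rw [← h5] at h7
      filter_upwards [Lp.coeFn_sub (hF.memLp.toLp _) S, hF.memLp.coeFn_toLp, h7] with x ha hb hc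
      rw [ha, Pi.sub_apply, hb, hc]
      simp [ContinuousMap.coe_sum]
    rw [@norm_sq_eq_re_inner ℂ, L2.inner_def]
    simp_rw [inner_self_eq_norm_sq_to_K]
    have h8 : ∫ x, ((‖(hF.memLp.toLp _ - S : Lp ℂ 2 (unif d)) x‖ : ℂ)) ^ 2 ∂unif d =
        ((∫ x, ‖(hF.memLp.toLp _ - S : Lp ℂ 2 (unif d)) x‖ ^ 2 ∂unif d : ℝ) : ℂ) := by
      refine Eq.trans (integral_congr_ae (ae_of_all _ fun x => ?_)) integral_ofReal
      exact (Complex.ofReal_pow _ _).symm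
    refine (congrArg RCLike.re h8).trans ?_
    rw [RCLike.re_to_complex, Complex.ofReal_re]
    refine integral_congr_ae ?_
    filter_upwards [h6] with x hx
    rw [hx]
  rw [← h4]
  calc _ ≤ √δ ^ 2 := pow_le_pow_left₀ (norm_nonneg _) h3.le 2
    _ = δ := Real.sq_sqrt hδ.le

end

lemma integral_mFourier {d : ℕ} {k : Fin d → ℤ} (hk : k ≠ 0) :
    ∫ x, UnitAddTorus.mFourier k x ∂unif d = 0 := by
  have h := (orthonormal_iff_ite.1 (UnitAddTorus.orthonormal_mFourier (d := Fin d))) 0 k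
  rw [if_neg hk.symm] at h
  rw [← h, ContinuousMap.inner_toLp, UnitAddTorus.mFourier_zero]
  simp only [ContinuousMap.one_apply, map_one, mul_one]
  rfl

lemma fourier_zero {d : ℕ} (F : Torus d → ℝ) : fourier F 0 = edgeDensity F := by
  rw [fourier_eq_integral, neg_zero, UnitAddTorus.mFourier_zero]
  simp only [ContinuousMap.one_apply, one_mul, edgeDensity]
  exact integral_ofReal

/-! ### The discretised limiting operator and its eigenfunctions -/

/-- The eigenvalues of the limiting integral operator. -/
def coeff {d : ℕ} (Fi Fo : Torus d → ℝ) (j : (Fin d → ℤ) × Fin 2) : ℂ :=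
  (fourier Fi j.1 + sgn j.2 * fourier Fo j.1) / 2

/-- The discretised eigenfunctions of the limiting integral operator. -/
def eigenfun {d n : ℕ} (σ : Labelling n) (X : Fin n → Torus d) (j : (Fin d → ℤ) × Fin 2) :
    EuclideanSpace ℂ (Fin n) :=
  WithLp.toLp 2 fun i =>
    UnitAddTorus.mFourier j.1 (X i) * (((if j.2 = 0 then 1 else sgn (σ i)) / √n : ℝ) : ℂ)

/-- The Fourier truncation of `connectivity`. -/
def truncConnectivity {d : ℕ} (Fi Fo : Torus d → ℝ) (K : Finset (Fin d → ℤ)) (x : Torus d)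
    (s t : Fin 2) : ℂ :=
  ∑ k ∈ K, fourier (if s = t then Fi else Fo) k * UnitAddTorus.mFourier k x

/-- Spectral decomposition, frequency by frequency, of the symmetric 2 × 2 matrix with `fourier Fi
k` on the diagonal and `fourier Fo k` off it: the eigenvectors are `(1, 1)` and `(1, -1)`. -/
lemma sum_coeff_mul {d : ℕ} (Fi Fo : Torus d → ℝ) (k : Fin d → ℤ) (s t : Fin 2) :
    ∑ e : Fin 2, coeff Fi Fo (k, e) *
      (((if e = 0 then 1 else sgn s) * (if e = 0 then 1 else sgn t) : ℝ) : ℂ) =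
    fourier (if s = t then Fi else Fo) k := by
  rw [Fin.sum_univ_two]
  fin_cases s <;> fin_cases t <;> simp [coeff, sgn] <;> ring

/-- The finite-rank operator built from the `eigenfun` is exactly the matrix of the truncated kernel
divided by `n`, because a character of `X i - X l` splits into a product. No orthogonality is
involved. -/
lemma sum_coeff_mul_inner {d n : ℕ} (Fi Fo : Torus d → ℝ) (K : Finset (Fin d → ℤ))
    (σ : Labelling n) (X : Fin n → Torus d) (v : Fin n → ℂ) (i : Fin n) :
    (∑ j : K × Fin 2, (coeff Fi Fo (j.1, j.2) *
      inner ℂ (eigenfun σ X (j.1, j.2)) (WithLp.toLp 2 v)) • eigenfun σ X (j.1, j.2)) i =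
    (∑ l, truncConnectivity Fi Fo K (X i - X l) (σ i) (σ l) * v l) / n := by
  have hn : ∀ x y : ℝ, (x / √n) * (y / √n) = x * y / n := fun x y => by
    rw [div_mul_div_comm, Real.mul_self_sqrt (Nat.cast_nonneg n)]
  have h1 : ∀ j : (Fin d → ℤ) × Fin 2, coeff Fi Fo j *
      inner ℂ (eigenfun σ X j) (WithLp.toLp 2 v) * eigenfun σ X j i =
      ∑ l, (coeff Fi Fo j * (((if j.2 = 0 then 1 else sgn (σ i)) *
        (if j.2 = 0 then 1 else sgn (σ l)) : ℝ) : ℂ)) *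
          UnitAddTorus.mFourier j.1 (X i - X l) * v l / n := fun j => by
    rw [PiLp.inner_apply, Finset.mul_sum, Finset.sum_mul]
    refine Finset.sum_congr rfl fun l _ => ?_
    have h2 := congrArg (fun r : ℝ => (r : ℂ))
      (hn (if j.2 = 0 then 1 else sgn (σ i)) (if j.2 = 0 then 1 else sgn (σ l)))
    simp only [Complex.ofReal_mul, Complex.ofReal_div (_ * _), Complex.ofReal_natCast] at h2
    simp only [eigenfun, RCLike.inner_apply, map_mul, Complex.conj_ofReal, mFourier_sub,
      Complex.ofReal_mul]
    linear_combination (coeff Fi Fo j * UnitAddTorus.mFourier j.1 (X i) *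
      starRingEnd ℂ (UnitAddTorus.mFourier j.1 (X l)) * v l) * h2
  set T : (Fin d → ℤ) → Fin 2 → Fin n → ℂ := fun k e l =>
    (coeff Fi Fo (k, e) * (((if e = 0 then 1 else sgn (σ i)) *
      (if e = 0 then 1 else sgn (σ l)) : ℝ) : ℂ)) *
        UnitAddTorus.mFourier k (X i - X l) * v l / n with hT
  calc _ = ∑ j : K × Fin 2, coeff Fi Fo (j.1, j.2) *
        inner ℂ (eigenfun σ X (j.1, j.2)) (WithLp.toLp 2 v) * eigenfun σ X (j.1, j.2) i := by
        rw [WithLp.ofLp_sum, Finset.sum_apply]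
        rfl
    _ = ∑ k : K, ∑ e, ∑ l, T k e l := by
        rw [Fintype.sum_prod_type]
        exact Finset.sum_congr rfl fun k _ => Finset.sum_congr rfl fun e _ => h1 _
    _ = ∑ k ∈ K, ∑ e, ∑ l, T k e l := Finset.sum_coe_sort K fun k => ∑ e, ∑ l, T k e l
    _ = ∑ l, ∑ k ∈ K, ∑ e, T k e l :=
        (Finset.sum_congr rfl fun k _ => Finset.sum_comm).trans Finset.sum_comm
    _ = _ := by
        rw [Finset.sum_div]
        refine Finset.sum_congr rfl fun l _ => ?_
        rw [truncConnectivity, Finset.sum_mul, Finset.sum_div]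
        refine Finset.sum_congr rfl fun k _ => ?_
        rw [← sum_coeff_mul, Finset.sum_mul, Finset.sum_mul, Finset.sum_div]

lemma inner_eigenfun {d n : ℕ} (σ : Labelling n) (X : Fin n → Torus d)
    (j j' : (Fin d → ℤ) × Fin 2) :
    inner ℂ (eigenfun σ X j) (eigenfun σ X j') =
      (∑ i, (((if j.2 = 0 then 1 else sgn (σ i)) * (if j'.2 = 0 then 1 else sgn (σ i)) : ℝ) : ℂ) *
        UnitAddTorus.mFourier (j'.1 - j.1) (X i)) / n := by
  have hn : ∀ x y : ℝ, (x / √n) * (y / √n) = x * y / n := fun x y => by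
    rw [div_mul_div_comm, Real.mul_self_sqrt (Nat.cast_nonneg n)]
  rw [PiLp.inner_apply, Finset.sum_div]
  refine Finset.sum_congr rfl fun i _ => ?_
  have h2 := congrArg (fun r : ℝ => (r : ℂ))
    (hn (if j.2 = 0 then 1 else sgn (σ i)) (if j'.2 = 0 then 1 else sgn (σ i)))
  simp only [Complex.ofReal_mul, Complex.ofReal_div (_ * _), Complex.ofReal_natCast] at h2
  simp only [eigenfun, RCLike.inner_apply, map_mul, Complex.conj_ofReal, sub_eq_add_neg,
    UnitAddTorus.mFourier_add, UnitAddTorus.mFourier_neg, Complex.ofReal_mul]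
  linear_combination (UnitAddTorus.mFourier j'.1 (X i) *
    starRingEnd ℂ (UnitAddTorus.mFourier j.1 (X i))) * h2

/-- The Gram matrix of eigenfunctions with the same frequency is exactly the identity. -/
lemma inner_eigenfun_same {d n : ℕ} (hn : 0 < n) {σ : Labelling n} (hσ : σ ∈ balanced n)
    (X : Fin n → Torus d) (k : Fin d → ℤ) (e e' : Fin 2) :
    inner ℂ (eigenfun σ X (k, e)) (eigenfun σ X (k, e')) = if e = e' then 1 else 0 := by
  have hn' : (n : ℂ) ≠ 0 := by exact_mod_cast hn.ne'
  have h0 : ∑ i, (sgn (σ i) : ℂ) = 0 := by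
    rw [← Complex.ofReal_sum, sum_sgn hσ, Complex.ofReal_zero]
  have h1 : ∀ i, (sgn (σ i) : ℂ) * sgn (σ i) = 1 := fun i => by
    rw [← Complex.ofReal_mul, sgn_mul_self, Complex.ofReal_one]
  rw [inner_eigenfun]
  fin_cases e <;> fin_cases e' <;>
    simp [UnitAddTorus.mFourier_zero, h0, h1, hn']

/-- Sums of a non-trivial character at independent uniform points. -/
lemma integral_norm_sum_mFourier_sq {d n : ℕ} {m : Fin d → ℤ} (hm : m ≠ 0) {a : Fin n → ℝ}
    (ha : ∀ i, a i * a i = 1) :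
    ∫ X : Fin n → Torus d, ‖∑ i, (a i : ℂ) * UnitAddTorus.mFourier m (X i)‖ ^ 2
      ∂(Measure.pi fun _ => unif d) = n := by
  have h1 : ∀ X : Fin n → Torus d,
      ((‖∑ i, (a i : ℂ) * UnitAddTorus.mFourier m (X i)‖ ^ 2 : ℝ) : ℂ) =
      ∑ i, ∑ j, ((a i * a j : ℝ) : ℂ) * UnitAddTorus.mFourier m (X i - X j) := fun X => by
    rw [Complex.ofReal_pow, ← Complex.mul_conj', map_sum, Finset.sum_mul_sum]
    refine Finset.sum_congr rfl fun i _ => Finset.sum_congr rfl fun j _ => ?_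
    rw [mFourier_sub, map_mul, Complex.conj_ofReal, Complex.ofReal_mul]
    ring
  have hint : ∀ i j : Fin n, Integrable (fun X : Fin n → Torus d =>
      UnitAddTorus.mFourier m (X i - X j)) (Measure.pi fun _ => unif d) := fun i j => by
    refine Integrable.of_bound ((UnitAddTorus.mFourier m).continuous.comp
      ((continuous_apply i).sub (continuous_apply j))).measurable.aestronglyMeasurable 1
      (ae_of_all _ fun X => (norm_mFourier_apply _ _).le)
  -- For `i ≠ j` the difference is uniform and a non-trivial character has mean zero; only the `n`
  -- diagonal terms survive.
  have h2 : ∀ i j : Fin n, ∫ X : Fin n → Torus d, UnitAddTorus.mFourier m (X i - X j)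
      ∂(Measure.pi fun _ => unif d) = if i = j then 1 else 0 := fun i j => by
    split_ifs with hij
    · subst hij
      have : UnitAddTorus.mFourier m (0 : Torus d) = 1 := by
        simp [UnitAddTorus.mFourier]
      simp [this]
    · have hmp := measurePreserving_difference (d := d) hij
      refine (integral_map hmp.measurable.aemeasurable
        (UnitAddTorus.mFourier m).continuous.measurable.aestronglyMeasurable).symm.trans ?_
      rw [hmp.map_eq, integral_mFourier hm]
  refine Complex.ofReal_injective (integral_ofReal.symm.trans ?_)
  refine (integral_congr_ae (ae_of_all _ h1)).trans ?_
  rw [integral_finsetSum _ fun i _ => integrable_finsetSum _ fun j _ => (hint i j).const_mul _]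
  simp_rw [integral_finsetSum _ fun j _ => (hint _ j).const_mul _, integral_const_mul, h2]
  simp [-Complex.ofReal_mul, ha]

section

variable {d : ℕ} {Fi Fo : Torus d → ℝ} (hFi : IsConnectivityFunction Fi)
  (hFo : IsConnectivityFunction Fo)

include hFi hFo

/-- Markov's inequality for a function of the labels and the positions. -/
lemma law_le_of_positions {n : ℕ} {f : Labelling n → (Fin n → Torus d) → ℝ}
    (hf0 : ∀ σ X, 0 ≤ f σ X) (hfm : ∀ σ, Measurable (f σ)) {B : Labelling n → ℝ}
    (hfB : ∀ σ X, f σ X ≤ B σ) {C : ℝ}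
    (hC : ∀ σ ∈ balanced n, ∫ X, f σ X ∂(Measure.pi fun _ => unif d) ≤ C) :
    law n Fi Fo {p | 1 ≤ f p.1.1 p.1.2} ≤ ENNReal.ofReal C := by
  refine law_le hFi hFo (f := fun ω _ => f ω.1 ω.2) (g := f) (fun ω _ => hf0 _ _)
    (fun _ => measurable_from_prod_countable_right fun σ => hfm σ) (fun σ _ X => ?_)
    (fun σ _ => ?_) hC
  · rw [← Finset.sum_mul]
    simp_rw [graphProb_eq]
    rw [sum_bernoulliProb, one_mul]
  · exact Integrable.of_bound (hfm σ).aestronglyMeasurable (B σ) (ae_of_all _ fun X => by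
      rw [Real.norm_of_nonneg (hf0 _ _)]
      exact hfB _ _)

/-- With high probability the discretised eigenfunctions are almost orthonormal. -/
lemma law_not_almostOrthonormal_le {n : ℕ} (hn : 0 < n) (K : Finset (Fin d → ℤ)) {η : ℝ}
    (hη : 0 < η) :
    law n Fi Fo {p | p.1.1 ∈ balanced n ∧ ¬ AlmostOrthonormal η
      fun j : K × Fin 2 => eigenfun p.1.1 p.1.2 (j.1, j.2)} ≤
      ENNReal.ofReal ((2 * K.card) ^ 2 / (η ^ 2 * n)) := by
  classical
  have hn' : (0 : ℝ) < n := by exact_mod_cast hn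
  set S : Labelling n → (Fin n → Torus d) → (Fin d → ℤ) × Fin 2 → (Fin d → ℤ) × Fin 2 → ℂ :=
    fun σ X j j' => ∑ i, (((if j.2 = 0 then 1 else sgn (σ i)) *
      (if j'.2 = 0 then 1 else sgn (σ i)) : ℝ) : ℂ) * UnitAddTorus.mFourier (j'.1 - j.1) (X i)
    with hS
  have ha : ∀ (σ : Labelling n) (e e' : Fin 2) (i : Fin n),
      ((if e = 0 then 1 else sgn (σ i)) * (if e' = 0 then 1 else sgn (σ i))) *
      ((if e = 0 then 1 else sgn (σ i)) * (if e' = 0 then 1 else sgn (σ i))) = 1 := by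
    intro σ e e' i
    generalize σ i = s
    fin_cases e <;> fin_cases e' <;> fin_cases s <;> simp [sgn]
  have hnorm : ∀ σ X j j', ‖S σ X j j'‖ ≤ n := fun σ X j j' => by
    refine (norm_sum_le _ _).trans ?_
    calc _ ≤ ∑ _i : Fin n, (1 : ℝ) := Finset.sum_le_sum fun i _ => by
          rw [norm_mul, norm_mFourier_apply, mul_one, Complex.norm_real, Real.norm_eq_abs]
          have := ha σ j.2 j'.2 i
          rw [← abs_mul_abs_self] at this
          nlinarith [abs_nonneg ((if j.2 = 0 then 1 else sgn (σ i)) *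
            (if j'.2 = 0 then 1 else sgn (σ i)))]
      _ = n := by simp
  have key : ∀ j j' : K × Fin 2, law n Fi Fo {p | p.1.1 ∈ balanced n ∧
      η < ‖inner ℂ (eigenfun p.1.1 p.1.2 (j.1, j.2)) (eigenfun p.1.1 p.1.2 (j'.1, j'.2)) -
        (if j = j' then 1 else 0)‖} ≤ ENNReal.ofReal (1 / (η ^ 2 * n)) := by
    rintro ⟨k, e⟩ ⟨k', e'⟩
    -- Equal frequencies are exact by balance. For distinct ones the inner product is `S / n` with
    -- `S` of second moment `n`, and Markov's inequality gives `1 / (η ^ 2 * n)`.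
    by_cases hk : k = k'
    · subst hk
      refine (measure_mono (t := ∅) ?_).trans (by simp)
      rintro p ⟨hσ, hp⟩
      rw [inner_eigenfun_same hn hσ] at hp
      simp [hη.not_gt] at hp
    · have hne : ((k', e').1 : Fin d → ℤ) - ((k, e).1 : Fin d → ℤ) ≠ 0 :=
        sub_ne_zero.2 fun h => hk (Subtype.ext h.symm)
      refine (measure_mono ?_).trans (law_le_of_positions hFi hFo
        (f := fun σ X => (η ^ 2 * n ^ 2)⁻¹ * ‖S σ X (k, e) (k', e')‖ ^ 2)
        (fun σ X => by positivity) (fun σ => ?_)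
        (B := fun _ => (η ^ 2 * n ^ 2)⁻¹ * (n : ℝ) ^ 2) (fun σ X => ?_) (fun σ _ => ?_))
      · rintro p ⟨_, hp⟩
        have : ¬ ((k, e) = (k', e')) := fun h => hk (Prod.ext_iff.1 h).1
        rw [if_neg this, sub_zero, inner_eigenfun, norm_div, lt_div_iff₀ (by simpa using hn),
          Complex.norm_natCast] at hp
        simp only [Set.mem_ofPred_eq]
        rw [inv_mul_eq_div, one_le_div (by positivity), ← mul_pow]
        exact pow_le_pow_left₀ (by positivity) hp.le 2
      · refine measurable_const.mul (Measurable.pow_const (Measurable.norm ?_) 2)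
        refine Finset.measurable_sum _ fun i _ => measurable_const.mul ?_
        exact (UnitAddTorus.mFourier _).continuous.measurable.comp (measurable_pi_apply i)
      · exact mul_le_mul_of_nonneg_left (pow_le_pow_left₀ (norm_nonneg _) (hnorm _ _ _ _) 2)
          (by positivity)
      · rw [integral_const_mul, integral_norm_sum_mFourier_sq hne (ha σ e e')]
        refine le_of_eq ?_
        field_simp
  have hsub : {p : (Labelling n × (Fin n → Torus d)) × SimpleGraph (Fin n) |
      p.1.1 ∈ balanced n ∧ ¬ AlmostOrthonormal η
        fun j : K × Fin 2 => eigenfun p.1.1 p.1.2 (j.1, j.2)} ⊆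
      ⋃ q : (K × Fin 2) × (K × Fin 2), {p | p.1.1 ∈ balanced n ∧
      η < ‖inner ℂ (eigenfun p.1.1 p.1.2 (q.1.1, q.1.2)) (eigenfun p.1.1 p.1.2 (q.2.1, q.2.2)) -
        (if q.1 = q.2 then 1 else 0)‖} := by
    rintro p ⟨hσ, hp⟩
    unfold AlmostOrthonormal at hp
    push Not at hp
    obtain ⟨i, j, hij⟩ := hp
    exact Set.mem_iUnion.2 ⟨(i, j), hσ, hij⟩
  refine (measure_mono hsub).trans ((measure_iUnion_fintype_le _ _).trans
    ((Finset.sum_le_sum fun q _ => key q.1 q.2).trans ?_))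
  rw [Finset.sum_const, nsmul_eq_mul, ← ENNReal.ofReal_natCast,
    ← ENNReal.ofReal_mul (Nat.cast_nonneg _)]
  refine ENNReal.ofReal_le_ofReal (le_of_eq ?_)
  simp
  ring

end

/-! ### Noise and truncation error in operator norm -/

/-- `‖M v‖ ^ 2` is the pairing of `v ⊗ v` with `Mᵀ M`, so Cauchy–Schwarz bounds it by `‖v‖ ^ 2`
times the Frobenius norm of `Mᵀ M`. The Frobenius norm of the noise itself may be of order `n`, too
large here; that of `Mᵀ M` is typically at most of order `n ^ (3 / 2)`, giving an operator norm of
order `n ^ (3 / 4)`. -/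
lemma sum_sq_mulVec_le {n : ℕ} {M : Fin n → Fin n → ℝ} {a : ℝ} (ha : 0 ≤ a)
    (h : ∑ i, ∑ j, (∑ k, M k i * M k j) ^ 2 ≤ a ^ 2) (v : Fin n → ℝ) :
    ∑ k, (∑ j, M k j * v j) ^ 2 ≤ a * ∑ j, v j ^ 2 := by
  have h1 : ∑ k, (∑ j, M k j * v j) ^ 2 =
      ∑ p : Fin n × Fin n, (v p.1 * v p.2) * ∑ k, M k p.1 * M k p.2 := by
    rw [Fintype.sum_prod_type]
    simp_rw [sq, Finset.sum_mul_sum, Finset.mul_sum]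
    rw [Finset.sum_comm]
    refine Finset.sum_congr rfl fun i _ => ?_
    rw [Finset.sum_comm]
    refine Finset.sum_congr rfl fun j _ => Finset.sum_congr rfl fun k _ => by ring
  have h2 := Finset.sum_mul_sq_le_sq_mul_sq Finset.univ (fun p : Fin n × Fin n => v p.1 * v p.2)
    fun p => ∑ k, M k p.1 * M k p.2
  rw [← h1] at h2
  have h3 : ∑ p : Fin n × Fin n, (v p.1 * v p.2) ^ 2 = (∑ j, v j ^ 2) ^ 2 := by
    rw [Fintype.sum_prod_type, sq, Finset.sum_mul_sum]
    simp_rw [mul_pow]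
  rw [h3, Fintype.sum_prod_type] at h2
  refine le_of_sq_le_sq (h2.trans ?_)
    (mul_nonneg ha (Finset.sum_nonneg fun _ _ => sq_nonneg _))
  rw [mul_pow, mul_comm]
  exact mul_le_mul_of_nonneg_right h (sq_nonneg _)

/-- The difference between the edge probabilities and the truncated kernel. -/
def truncError {d n : ℕ} (Fi Fo : Torus d → ℝ) (K : Finset (Fin d → ℤ)) (σ : Labelling n)
    (X : Fin n → Torus d) (i l : Fin n) : ℂ :=
  ((if i = l then 0 else edgeProb Fi Fo σ X i l : ℝ) : ℂ) -
    truncConnectivity Fi Fo K (X i - X l) (σ i) (σ l)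

open Classical in
lemma adjMatrix_sub_truncConnectivity {d n : ℕ} (Fi Fo : Torus d → ℝ) (K : Finset (Fin d → ℤ))
    (σ : Labelling n) (X : Fin n → Torus d) (G : SimpleGraph (Fin n)) (i l : Fin n) :
    (G.adjMatrix ℝ i l : ℂ) - truncConnectivity Fi Fo K (X i - X l) (σ i) (σ l) =
      noise (edgeProb Fi Fo σ X) G i l + truncError Fi Fo K σ X i l := by
  rw [SimpleGraph.adjMatrix_apply, noise, truncError]
  by_cases h : i = l
  · subst h
    simp
  · by_cases h' : G.Adj i l <;> (simp [h, h']; try ring)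

-- The difference is `(noise + truncError) / n`. The noise is controlled through `sum_sq_mulVec_le`,
-- the truncation error by its Frobenius norm; the factor 2 comes from `(x + y) ^ 2 ≤ 2 x ^ 2 + 2 y
-- ^ 2`.
open Classical in
lemma norm_adjMatrix_sub_le {d n : ℕ} (hn : 0 < n) (Fi Fo : Torus d → ℝ)
    (K : Finset (Fin d → ℤ)) (σ : Labelling n) (X : Fin n → Torus d) (G : SimpleGraph (Fin n))
    {a b : ℝ} (ha : 0 ≤ a)
    (hS : ∑ i, ∑ j, (∑ k, noise (edgeProb Fi Fo σ X) G k i * noise (edgeProb Fi Fo σ X) G k j) ^ 2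
      ≤ a ^ 2)
    (hQ : ∑ i, ∑ l, ‖truncError Fi Fo K σ X i l‖ ^ 2 ≤ b) (v : Fin n → ℝ) :
    ‖(WithLp.toLp 2 fun i => (((∑ j, G.adjMatrix ℝ i j * v j) / n : ℝ) : ℂ) :
        EuclideanSpace ℂ (Fin n)) -
      ∑ j : K × Fin 2, (coeff Fi Fo (j.1, j.2) * inner ℂ (eigenfun σ X (j.1, j.2))
        (WithLp.toLp 2 fun i => (v i : ℂ))) • eigenfun σ X (j.1, j.2)‖ ^ 2 ≤
    2 * (a + b) / n ^ 2 * ∑ i, v i ^ 2 := by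
  have hn' : (0 : ℝ) < n := by exact_mod_cast hn
  set E := noise (edgeProb Fi Fo σ X) G with hE
  set D := truncError Fi Fo K σ X with hD
  have hcoord : ∀ i, ((WithLp.toLp 2 fun i => (((∑ j, G.adjMatrix ℝ i j * v j) / n : ℝ) : ℂ) :
        EuclideanSpace ℂ (Fin n)) -
      ∑ j : K × Fin 2, (coeff Fi Fo (j.1, j.2) * inner ℂ (eigenfun σ X (j.1, j.2))
        (WithLp.toLp 2 fun i => (v i : ℂ))) • eigenfun σ X (j.1, j.2)) i =
      (((∑ l, E i l * v l : ℝ) : ℂ) + ∑ l, D i l * v l) / n := fun i => by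
    rw [PiLp.sub_apply, sum_coeff_mul_inner]
    simp only [Complex.ofReal_div, Complex.ofReal_sum, Complex.ofReal_mul, Complex.ofReal_natCast]
    rw [← sub_div, ← Finset.sum_sub_distrib, ← Finset.sum_add_distrib]
    congr 1
    refine Finset.sum_congr rfl fun l _ => ?_
    rw [← sub_mul, adjMatrix_sub_truncConnectivity, add_mul]
  have hDv : ∀ i, ‖∑ l, D i l * v l‖ ^ 2 ≤ (∑ l, ‖D i l‖ ^ 2) * ∑ l, v l ^ 2 := fun i => by
    have h1 : ‖∑ l, D i l * v l‖ ≤ ∑ l, ‖D i l‖ * |v l| :=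
      (norm_sum_le _ _).trans (le_of_eq (Finset.sum_congr rfl fun l _ => by
        rw [norm_mul, Complex.norm_real, Real.norm_eq_abs]))
    refine (pow_le_pow_left₀ (norm_nonneg _) h1 2).trans
      ((Finset.sum_mul_sq_le_sq_mul_sq _ _ _).trans (le_of_eq ?_))
    simp_rw [sq_abs]
  have hV : 0 ≤ ∑ i, v i ^ 2 := Finset.sum_nonneg fun _ _ => sq_nonneg _
  rw [EuclideanSpace.norm_sq_eq]
  calc _ ≤ ∑ i, (2 * (∑ l, E i l * v l) ^ 2 + 2 * ((∑ l, ‖D i l‖ ^ 2) * ∑ l, v l ^ 2)) / n ^ 2 := by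
        refine Finset.sum_le_sum fun i _ => ?_
        rw [hcoord, norm_div, Complex.norm_natCast, div_pow]
        refine div_le_div_of_nonneg_right ?_ (by positivity)
        have h1 := norm_add_le ((∑ l, E i l * v l : ℝ) : ℂ) (∑ l, D i l * v l)
        rw [Complex.norm_real, Real.norm_eq_abs] at h1
        have h2 := pow_le_pow_left₀ (norm_nonneg _) h1 2
        have h3 := hDv i
        have h4 := sq_abs (∑ l, E i l * v l)
        nlinarith [sq_nonneg (|∑ l, E i l * v l| - ‖∑ l, D i l * v l‖)]
    _ = (2 * ∑ i, (∑ l, E i l * v l) ^ 2 +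
          2 * ((∑ i, ∑ l, ‖D i l‖ ^ 2) * ∑ l, v l ^ 2)) / n ^ 2 := by
        rw [← Finset.sum_div, Finset.sum_add_distrib, ← Finset.mul_sum, ← Finset.mul_sum,
          ← Finset.sum_mul]
    _ ≤ (2 * (a * ∑ l, v l ^ 2) + 2 * (b * ∑ l, v l ^ 2)) / n ^ 2 := by
        have := sum_sq_mulVec_le ha hS v
        gcongr
    _ = _ := by ring

section

variable {d : ℕ} {Fi Fo : Torus d → ℝ} (hFi : IsConnectivityFunction Fi)
  (hFo : IsConnectivityFunction Fo)

include hFi hFo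

lemma law_not_balanced {n : ℕ} : law n Fi Fo {p | p.1.1 ∉ balanced n} = 0 := by
  classical
  have h := law_le_of_positions hFi hFo (n := n)
    (f := fun σ _ => if σ ∈ balanced n then 0 else 1) (C := 0) (B := fun _ => 1)
    (fun σ X => by split_ifs <;> norm_num) (fun σ => measurable_const)
    (fun σ X => by split_ifs <;> norm_num) (fun σ hσ => by simp [hσ])
  rw [ENNReal.ofReal_zero] at h
  refine le_antisymm ((measure_mono fun p hp => ?_).trans h) zero_le
  have hp' : p.1.1 ∉ balanced n := hp
  simp [hp']

/-- With high probability the centred adjacency matrix has small operator norm. -/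
lemma law_noise_le {n : ℕ} {a : ℝ} (ha : 0 < a) :
    law n Fi Fo {p | a ^ 2 < ∑ i, ∑ j, (∑ k, noise (edgeProb Fi Fo p.1.1 p.1.2) p.2 k i *
      noise (edgeProb Fi Fo p.1.1 p.1.2) p.2 k j) ^ 2} ≤
      ENNReal.ofReal (2 * n ^ 3 / a ^ 2) := by
  have hm : ∀ (G : SimpleGraph (Fin n)) (i j : Fin n),
      Measurable fun ω : Labelling n × (Fin n → Torus d) =>
        noise (edgeProb Fi Fo ω.1 ω.2) G i j := fun G i j => by
    unfold noise
    split_ifs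
    · exact measurable_const
    · exact measurable_const.sub (measurable_edgeProb hFi hFo i j)
    · exact (measurable_edgeProb hFi hFo i j).neg
  refine (measure_mono ?_).trans (law_le hFi hFo (f := fun ω G => (a ^ 2)⁻¹ *
    ∑ i, ∑ j, (∑ k, noise (edgeProb Fi Fo ω.1 ω.2) G k i *
      noise (edgeProb Fi Fo ω.1 ω.2) G k j) ^ 2) (g := fun _ _ => 2 * n ^ 3 / a ^ 2)
    (fun ω G => mul_nonneg (by positivity)
      (Finset.sum_nonneg fun i _ => Finset.sum_nonneg fun j _ => sq_nonneg _))
    (fun G => ?_) (fun σ _ X => ?_) (fun σ _ => integrable_const _) (fun σ _ => by simp))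
  · intro p hp
    simp only [Set.mem_ofPred_eq] at hp ⊢
    rw [inv_mul_eq_div, one_le_div (by positivity)]
    exact hp.le
  · exact measurable_const.mul (Finset.measurable_sum _ fun i _ => Finset.measurable_sum _
      fun j _ => (Finset.measurable_sum _ fun k _ => (hm G k i).mul (hm G k j)).pow_const 2)
  · have h := sum_bernoulliProb_mul_noise_sq_le (edgeProb_mem hFi hFo σ X)
      (edgeProb_symm hFi hFo σ X)
    rw [le_div_iff₀ (by positivity), Finset.sum_mul]
    refine le_trans (le_of_eq (Finset.sum_congr rfl fun G _ => ?_)) h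
    rw [graphProb_eq]
    field_simp

lemma norm_truncConnectivity_le (K : Finset (Fin d → ℤ)) (x : Torus d) (s t : Fin 2) :
    ‖truncConnectivity Fi Fo K x s t‖ ≤ K.card := by
  refine (norm_sum_le _ _).trans ?_
  calc _ ≤ ∑ _k ∈ K, (1 : ℝ) := Finset.sum_le_sum fun k _ => by
        rw [norm_mul, norm_mFourier_apply, mul_one]
        split_ifs
        · exact norm_fourier_le hFi k
        · exact norm_fourier_le hFo k
    _ = _ := by simp

omit hFi hFo in
lemma continuous_truncConnectivity (K : Finset (Fin d → ℤ)) (s t : Fin 2) :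
    Continuous fun x => truncConnectivity Fi Fo K x s t :=
  continuous_finsetSum _ fun k _ => continuous_const.mul (UnitAddTorus.mFourier k).continuous

lemma norm_truncError_le {n : ℕ} (K : Finset (Fin d → ℤ)) (σ : Labelling n)
    (X : Fin n → Torus d) (i l : Fin n) : ‖truncError Fi Fo K σ X i l‖ ≤ 1 + K.card := by
  refine (norm_sub_le _ _).trans (add_le_add ?_ (norm_truncConnectivity_le hFi hFo _ _ _ _))
  rw [Complex.norm_real]
  split_ifs
  · simp
  · have := edgeProb_mem hFi hFo σ X i l
    rw [Real.norm_of_nonneg this.1]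
    exact this.2

lemma measurable_truncError {n : ℕ} (K : Finset (Fin d → ℤ)) (σ : Labelling n) (i l : Fin n) :
    Measurable fun X => truncError Fi Fo K σ X i l := by
  unfold truncError
  refine Measurable.sub ?_ ((continuous_truncConnectivity K _ _).measurable.comp
    ((measurable_pi_apply i).sub (measurable_pi_apply l)))
  refine Complex.measurable_ofReal.comp ?_
  split_ifs
  · exact measurable_const
  · exact (measurable_edgeProb hFi hFo i l).comp measurable_prodMk_left

/-- Off the diagonal `X i - X l` is uniform, so the mean is the `L²` truncation error. On the
diagonal the graph has no loops while the truncated kernel is non-zero in general, hence the extra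
term. -/
lemma integral_norm_truncError_sq_le {n : ℕ} (K : Finset (Fin d → ℤ)) {δ : ℝ}
    (hδ : ∀ s t, ∫ x, ‖(connectivity Fi Fo x s t : ℂ) - truncConnectivity Fi Fo K x s t‖ ^ 2
      ∂unif d ≤ δ) (σ : Labelling n) (i l : Fin n) :
    ∫ X, ‖truncError Fi Fo K σ X i l‖ ^ 2 ∂(Measure.pi fun _ => unif d) ≤
      δ + if i = l then (K.card : ℝ) ^ 2 else 0 := by
  have hδ0 : 0 ≤ δ := (integral_nonneg fun x => by positivity).trans (hδ 0 0)
  by_cases h : i = l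
  · subst h
    have h1 : ∀ X, ‖truncError Fi Fo K σ X i i‖ ^ 2 ≤ (K.card : ℝ) ^ 2 := fun X => by
      simp only [truncError, if_true, Complex.ofReal_zero, zero_sub, norm_neg]
      exact pow_le_pow_left₀ (norm_nonneg _) (norm_truncConnectivity_le hFi hFo _ _ _ _) 2
    have h2 := integral_mono_of_nonneg (μ := Measure.pi fun _ : Fin n => unif d)
      (ae_of_all _ fun X => by positivity) (integrable_const _) (ae_of_all _ h1)
    simp only [if_true]
    refine h2.trans ?_
    simp [hδ0]
  · rw [if_neg h, add_zero]
    refine le_trans (le_of_eq ?_) (hδ (σ i) (σ l))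
    have hmp := measurePreserving_difference (d := d) h
    conv_rhs => rw [← hmp.map_eq]
    rw [integral_map hmp.measurable.aemeasurable]
    · simp only [truncError, if_neg h, edgeProb]
    · exact (((Complex.measurable_ofReal.comp (measurable_connectivity hFi hFo _ _)).sub
        (continuous_truncConnectivity K _ _).measurable).norm.pow_const 2).aestronglyMeasurable

/-- With high probability the truncation error has small Frobenius norm. -/
lemma law_truncError_le {n : ℕ} (K : Finset (Fin d → ℤ)) {δ b : ℝ} (hb : 0 < b)
    (hδ : ∀ s t, ∫ x, ‖(connectivity Fi Fo x s t : ℂ) - truncConnectivity Fi Fo K x s t‖ ^ 2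
      ∂unif d ≤ δ) :
    law n Fi Fo {p | b < ∑ i, ∑ l, ‖truncError Fi Fo K p.1.1 p.1.2 i l‖ ^ 2} ≤
      ENNReal.ofReal ((n ^ 2 * δ + n * K.card ^ 2) / b) := by
  have hint : ∀ (σ : Labelling n) (i l : Fin n), Integrable
      (fun X => ‖truncError Fi Fo K σ X i l‖ ^ 2) (Measure.pi fun _ => unif d) := fun σ i l =>
    Integrable.of_bound
      ((measurable_truncError hFi hFo K σ i l).norm.pow_const 2).aestronglyMeasurable
      ((1 + K.card : ℝ) ^ 2) (ae_of_all _ fun X => by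
        rw [Real.norm_of_nonneg (by positivity)]
        exact pow_le_pow_left₀ (norm_nonneg _) (norm_truncError_le hFi hFo K σ X i l) 2)
  refine (measure_mono ?_).trans (law_le_of_positions hFi hFo
    (f := fun σ X => b⁻¹ * ∑ i, ∑ l, ‖truncError Fi Fo K σ X i l‖ ^ 2)
    (B := fun _ => b⁻¹ * ∑ _i : Fin n, ∑ _l : Fin n, ((1 + K.card : ℝ) ^ 2))
    (fun σ X => by positivity) (fun σ => ?_) (fun σ X => ?_) (fun σ _ => ?_))
  · intro p hp
    simp only [Set.mem_ofPred_eq] at hp ⊢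
    rw [inv_mul_eq_div, one_le_div hb]
    exact hp.le
  · exact measurable_const.mul (Finset.measurable_sum _ fun i _ => Finset.measurable_sum _
      fun l _ => (measurable_truncError hFi hFo K σ i l).norm.pow_const 2)
  · refine mul_le_mul_of_nonneg_left ?_ (by positivity)
    exact Finset.sum_le_sum fun i _ => Finset.sum_le_sum fun l _ =>
      pow_le_pow_left₀ (norm_nonneg _) (norm_truncError_le hFi hFo K σ X i l) 2
  · rw [integral_const_mul, inv_mul_eq_div]
    refine div_le_div_of_nonneg_right ?_ hb.le
    rw [integral_finsetSum _ fun i _ => integrable_finsetSum _ fun l _ => hint σ i l]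
    simp_rw [integral_finsetSum _ fun l _ => hint σ _ l]
    calc _ ≤ ∑ i : Fin n, ∑ l : Fin n, (δ + if i = l then (K.card : ℝ) ^ 2 else 0) :=
          Finset.sum_le_sum fun i _ => Finset.sum_le_sum fun l _ =>
            integral_norm_truncError_sq_le hFi hFo K hδ σ i l
      _ = _ := by
          simp [Finset.sum_add_distrib]
          ring

end

/-! ### Spectral gap, truncation and the failure probability -/

section

variable {d : ℕ} {Fi Fo : Torus d → ℝ} (hFi : IsConnectivityFunction Fi)
  (hFo : IsConnectivityFunction Fo)

lemma coeff_zero_one : coeff Fi Fo (0, 1) = (((edgeDensity Fi - edgeDensity Fo) / 2 : ℝ) : ℂ) := by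
  simp only [coeff, fourier_zero, sgn]
  push_cast
  norm_num
  ring

include hFi hFo

lemma norm_coeff_le (j : (Fin d → ℤ) × Fin 2) : ‖coeff Fi Fo j‖ ≤ 1 := by
  have h1 := norm_fourier_le hFi j.1
  have h2 := norm_fourier_le hFo j.1
  have h3 := norm_add_le (fourier Fi j.1) (sgn j.2 * fourier Fo j.1)
  rw [norm_mul, Complex.norm_real, Real.norm_eq_abs, abs_sgn, one_mul] at h3
  rw [coeff, norm_div, RCLike.norm_ofNat]
  linarith

/-- The eigenvalue of the community structure is isolated from the other ones. -/
lemma exists_gap {L : ℝ} (hL : L ≠ 0) (h : ∀ j, j ≠ (0, 1) → coeff Fi Fo j ≠ L) :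
    ∃ γ : ℝ, 0 < γ ∧ ∀ j, j ≠ (0, 1) → γ ≤ ‖coeff Fi Fo j - L‖ := by
  have hL' : 0 < |L| / 2 := by positivity
  -- Apart from finitely many frequencies both coefficients are below `|L| / 2`, and then `coeff` is
  -- at distance at least `|L| / 2` from `L`. The remaining finitely many values differ from `L` by
  -- hypothesis.
  have hfin : {k : Fin d → ℤ | ¬ (‖fourier Fi k‖ < |L| / 2 ∧ ‖fourier Fo k‖ < |L| / 2)}.Finite := by
    have h1 := (tendsto_zero_iff_norm_tendsto_zero.1 (tendsto_fourier hFi)).eventually_lt_const hL'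
    have h2 := (tendsto_zero_iff_norm_tendsto_zero.1 (tendsto_fourier hFo)).eventually_lt_const hL'
    exact Filter.eventually_cofinite.1 (h1.and h2)
  have hfin2 : {j : (Fin d → ℤ) × Fin 2 |
      ¬ (‖fourier Fi j.1‖ < |L| / 2 ∧ ‖fourier Fo j.1‖ < |L| / 2) ∧ j ≠ (0, 1)}.Finite :=
    (hfin.prod (Set.finite_univ (α := Fin 2))).subset fun j hj =>
      Set.mem_prod.2 ⟨hj.1, Set.mem_univ _⟩
  have h3 : ∀ᶠ γ in 𝓝[>] (0 : ℝ), ∀ j ∈ hfin2.toFinset, γ ≤ ‖coeff Fi Fo j - L‖ := by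
    refine (Filter.eventually_all_finset _).2 fun j hj => ?_
    rw [Set.Finite.mem_toFinset] at hj
    have : 0 < ‖coeff Fi Fo j - L‖ := norm_pos_iff.2 (sub_ne_zero.2 (h j hj.2))
    filter_upwards [Ioc_mem_nhdsGT this] with γ hγ using hγ.2
  obtain ⟨γ, h4, h5⟩ := (h3.and (Ioc_mem_nhdsGT hL')).exists
  refine ⟨γ, h5.1, fun j hj => ?_⟩
  by_cases hj' : ‖fourier Fi j.1‖ < |L| / 2 ∧ ‖fourier Fo j.1‖ < |L| / 2
  · have h6 := norm_add_le (fourier Fi j.1) (sgn j.2 * fourier Fo j.1)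
    rw [norm_mul, Complex.norm_real, Real.norm_eq_abs, abs_sgn, one_mul] at h6
    have h7 : ‖coeff Fi Fo j‖ ≤ |L| / 2 := by
      rw [coeff, norm_div, RCLike.norm_ofNat]
      linarith [hj'.1, hj'.2]
    have h8 := norm_sub_norm_le (L : ℂ) (coeff Fi Fo j)
    rw [Complex.norm_real, Real.norm_eq_abs, norm_sub_rev] at h8
    linarith [h5.2]
  · exact h4 j (hfin2.mem_toFinset.2 ⟨hj', hj⟩)

lemma exists_truncation {δ : ℝ} (hδ : 0 < δ) : ∃ K : Finset (Fin d → ℤ), 0 ∈ K ∧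
    ∀ s t, ∫ x, ‖(connectivity Fi Fo x s t : ℂ) - truncConnectivity Fi Fo K x s t‖ ^ 2
      ∂unif d ≤ δ := by
  classical
  obtain ⟨Ki, hKi⟩ := exists_integral_sub_sum_sq_le hFi hδ
  obtain ⟨Ko, hKo⟩ := exists_integral_sub_sum_sq_le hFo hδ
  -- Frequency zero is forced in because it carries the community eigenfunction.
  refine ⟨insert 0 (Ki ∪ Ko), Finset.mem_insert_self _ _, fun s t => ?_⟩
  by_cases h : s = t
  · simp only [connectivity, truncConnectivity, if_pos h]
    exact hKi _ (Finset.subset_union_left.trans (Finset.subset_insert _ _))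
  · simp only [connectivity, truncConnectivity, if_neg h]
    exact hKo _ (Finset.subset_union_right.trans (Finset.subset_insert _ _))

/-- An explicit bound on the probability that the algorithm fails. -/
lemma law_loss_pos_le {L : ℝ} (hL : L = (edgeDensity Fi - edgeDensity Fo) / 2) (hL0 : L ≠ 0)
    {γ : ℝ} (hγ : 0 < γ) (hgap : ∀ j, j ≠ (0, 1) → γ ≤ ‖coeff Fi Fo j - L‖)
    {ε : ℝ} (hε0 : 0 < ε) (hε1 : ε ≤ 1) (hεγ : ε ≤ γ / 2) (hεL : ε + 7 * ε / γ ≤ L ^ 2 / 8)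
    {K : Finset (Fin d → ℤ)} (hK : 0 ∈ K) {δ : ℝ}
    (hδ : ∀ s t, ∫ x, ‖(connectivity Fi Fo x s t : ℂ) - truncConnectivity Fi Fo K x s t‖ ^ 2
      ∂unif d ≤ δ)
    {η : ℝ} (hη : 0 < η) (hηJ : η * (2 * K.card) ≤ 1)
    (hηε : 8 * η ^ 2 * (2 * K.card : ℝ) ^ 3 ≤ ε ^ 2)
    {n : ℕ} (hn : 0 < n) (hnε : 2 / ε ≤ n) {est : SimpleGraph (Fin n) → Labelling n}
    (hest : ∀ G, IsHOSCLIOutput (edgeDensity Fi) (edgeDensity Fo) G (est G)) :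
    law n Fi Fo {ω | 0 < loss ω.1.1 (est ω.2)} ≤ ENNReal.ofReal
      (n * (2 * Real.exp (-((ε / 2) ^ 2 / 4) * n)) + 2 * n ^ 3 / (ε ^ 2 * n ^ 2 / 4) ^ 2 +
        (n ^ 2 * δ + n * K.card ^ 2) / (ε ^ 2 * n ^ 2 / 4) + (2 * K.card) ^ 2 / (η ^ 2 * n)) := by
  classical
  have hn' : (0 : ℝ) < n := by exact_mod_cast hn
  have hδ0 : 0 ≤ δ := (integral_nonneg fun x => by positivity).trans (hδ 0 0)
  -- This is the threshold for both noise and truncation error: with `a = b = ε ^ 2 * n ^ 2 / 4` the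
  -- bound `2 * (a + b) / n ^ 2` equals `ε ^ 2`.
  have ha : 0 < ε ^ 2 * n ^ 2 / 4 := by positivity
  have h1 := law_not_balanced hFi hFo (n := n)
  have h2 := law_exists_deviation_le hFi hFo (n := n) (half_pos hε0) (by linarith)
  have h3 := law_noise_le hFi hFo (n := n) ha
  have h4 := law_truncError_le hFi hFo (n := n) K ha hδ
  have h5 := law_not_almostOrthonormal_le hFi hFo hn K hη
  rw [ENNReal.ofReal_add (by positivity) (by positivity),
    ENNReal.ofReal_add (by positivity) (by positivity),
    ENNReal.ofReal_add (by positivity) (by positivity)]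
  rw [← zero_add (ENNReal.ofReal (n * (2 * Real.exp (-((ε / 2) ^ 2 / 4) * n))))]
  refine le_trans (measure_mono ?_) ((measure_union_le _ _).trans (add_le_add
    ((measure_union_le _ _).trans (add_le_add ((measure_union_le _ _).trans (add_le_add
      ((measure_union_le _ _).trans (add_le_add h1.le h2)) h3)) h4)) h5))
  intro p hp
  by_contra hcon
  simp only [Set.mem_union, Set.mem_ofPred_eq, not_or, not_not, not_and, not_exists, not_le,
    not_lt] at hcon
  obtain ⟨⟨⟨⟨hbal, hdev⟩, hnoise⟩, htrunc⟩, hgram⟩ := hcon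
  have hcard : Fintype.card (K × Fin 2) = K.card * 2 := by simp
  have hcard' : ((Fintype.card (K × Fin 2) : ℕ) : ℝ) = 2 * K.card := by
    rw [hcard]
    push_cast
    ring
  have hzero : loss p.1.1 (est p.2) = 0 := by
    refine loss_eq_zero_of_good hn hL hL0 (hest p.2) (J := K × Fin 2)
      (φ := fun j => eigenfun p.1.1 p.1.2 (j.1, j.2)) (c := fun j => coeff Fi Fo (j.1, j.2))
      (k := (⟨0, hK⟩, 1)) hε0.le hγ hη.le (by rwa [hcard']) (by rwa [hcard']) (fun i => ?_)
      (by rw [coeff_zero_one, hL]) (fun j => norm_coeff_le hFi hFo _) (fun j hj => ?_) hεγ hεL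
      (fun i => ?_) (hgram hbal) (fun v => ?_)
    · simp [eigenfun, UnitAddTorus.mFourier_zero]
    · refine hgap _ fun h => hj ?_
      rw [Prod.mk.injEq] at h
      exact Prod.ext (Subtype.ext h.1) h.2
    · have h6 := (hdev i).le
      rw [deviation_eq hbal] at h6
      have h7 : |edgeDensity Fi * sgn (p.1.1 i)| ≤ 1 := by
        rw [abs_mul, abs_sgn, mul_one]
        have := meanProb_mem hFi hFo 0 0
        simp only [meanProb, connectivity, if_true] at this
        exact abs_le.2 ⟨by linarith [this.1, show edgeDensity Fi = ∫ x, Fi x ∂unif d from rfl],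
          this.2⟩
      -- Half of the tolerance `ε * n` goes to the deviation, half to the diagonal correction, which
      -- is at most 1.
      have h8 : 1 ≤ ε / 2 * n := by
        rw [div_le_iff₀ hε0] at hnε
        linarith
      rw [← hL] at h6
      have h9 := abs_sub (∑ j, p.2.adjMatrix ℝ i j * sgn (p.1.1 j) - L * n * sgn (p.1.1 i) +
        edgeDensity Fi * sgn (p.1.1 i)) (edgeDensity Fi * sgn (p.1.1 i))
      rw [add_sub_cancel_right] at h9
      linarith
    · refine (norm_adjMatrix_sub_le hn Fi Fo K p.1.1 p.1.2 p.2 ha.le hnoise htrunc v).trans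
        (le_of_eq ?_)
      congr 1
      field_simp
      ring
  have hp' : 0 < loss p.1.1 (est p.2) := hp
  exact absurd hzero hp'.ne'

end

end SGBM

end

/-! ### The theorem: choice of the parameters -/

theorem mainTheorem2 {d : ℕ} (Fi Fo : SGBM.Torus d → ℝ)
    (hFi : SGBM.IsConnectivityFunction Fi) (hFo : SGBM.IsConnectivityFunction Fo)
    (hμ : SGBM.edgeDensity Fi ≠ SGBM.edgeDensity Fo)
    (hsum : ∀ k : Fin d → ℤ, SGBM.fourier Fi k + SGBM.fourier Fo k ≠
      ((SGBM.edgeDensity Fi - SGBM.edgeDensity Fo : ℝ) : ℂ))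
    (hdiff : ∀ k : Fin d → ℤ, k ≠ 0 → SGBM.fourier Fi k - SGBM.fourier Fo k ≠
      ((SGBM.edgeDensity Fi - SGBM.edgeDensity Fo : ℝ) : ℂ))
    (est : ∀ n : ℕ, SimpleGraph (Fin n) → SGBM.Labelling n)
    (hest : ∀ n : ℕ, 0 < n → ∀ G : SimpleGraph (Fin n),
      SGBM.IsHOSCLIOutput (SGBM.edgeDensity Fi) (SGBM.edgeDensity Fo) G (est n G)) :
    SGBM.StronglyConsistent Fi Fo est := by
  set L : ℝ := (SGBM.edgeDensity Fi - SGBM.edgeDensity Fo) / 2 with hL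
  have hL0 : L ≠ 0 := div_ne_zero (sub_ne_zero.2 hμ) two_ne_zero
  have hLc : ((SGBM.edgeDensity Fi - SGBM.edgeDensity Fo : ℝ) : ℂ) = 2 * L := by
    rw [hL]
    push_cast
    ring
  rw [hLc] at hsum hdiff
  -- The excluded index `(0, 1)` is that of `L` itself, which is why `hdiff` leaves out `k = 0`.
  obtain ⟨γ, hγ, hgap⟩ := SGBM.exists_gap hFi hFo hL0 (by
    rintro ⟨k, e⟩ hj h
    have h2 : SGBM.fourier Fi k + SGBM.sgn e * SGBM.fourier Fo k = 2 * L := by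
      rw [← h, SGBM.coeff]
      ring
    fin_cases e
    · exact hsum k (by simpa [SGBM.sgn] using h2)
    · refine hdiff k (fun hk => hj (by rw [hk]; rfl)) ?_
      simpa [SGBM.sgn, sub_eq_add_neg] using h2)
  obtain ⟨ε, hε0, hε1, hεγ, hεL⟩ : ∃ ε : ℝ, 0 < ε ∧ ε ≤ 1 ∧ ε ≤ γ / 2 ∧
      ε + 7 * ε / γ ≤ L ^ 2 / 8 := by
    have hc : 0 < 1 + 7 / γ := by positivity
    have hL2 : 0 < L ^ 2 / 8 := by positivity
    refine ⟨min (min 1 (γ / 2)) (L ^ 2 / 8 / (1 + 7 / γ)), by positivity,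
      (min_le_left _ _).trans (min_le_left _ _), (min_le_left _ _).trans (min_le_right _ _), ?_⟩
    have h1 := min_le_right (min 1 (γ / 2)) (L ^ 2 / 8 / (1 + 7 / γ))
    rw [le_div_iff₀ hc] at h1
    refine le_of_eq_of_le ?_ h1
    ring
  unfold SGBM.StronglyConsistent
  rw [ENNReal.tendsto_nhds_zero]
  intro ρ' hρ'
  obtain ⟨ρ, hρ0, hρ⟩ : ∃ ρ : ℝ, 0 < ρ ∧ ENNReal.ofReal ρ ≤ ρ' := by
    obtain ⟨r, hr0, hr⟩ := ENNReal.lt_iff_exists_nnreal_btwn.1 hρ'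
    exact ⟨r, by exact_mod_cast hr0, by rw [ENNReal.ofReal_coe_nnreal]; exact hr.le⟩
  -- The value of `δ` makes the truncation term `n ^ 2 * δ / (ε ^ 2 * n ^ 2 / 4)` equal to `ρ / 4`,
  -- the only part of the failure bound that does not vanish as `n` grows.
  obtain ⟨K, hK0, hK⟩ := SGBM.exists_truncation hFi hFo (δ := ε ^ 2 * ρ / 16) (by positivity)
  set N : ℝ := 2 * K.card with hN
  have hN0 : 0 ≤ N := by positivity
  -- Then `8 * η ^ 2 * N ^ 3 = ε ^ 2 / 2 * N ^ 3 / (N + 1) ^ 4`, below `ε ^ 2`.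
  set η : ℝ := ε / (4 * (N + 1) ^ 2) with hη
  have hη0 : 0 < η := by positivity
  have hηJ : η * N ≤ 1 := by
    rw [hη, div_mul_eq_mul_div, div_le_one (by positivity)]
    nlinarith
  have hηε : 8 * η ^ 2 * N ^ 3 ≤ ε ^ 2 := by
    have h1 : N ^ 3 ≤ (N + 1) ^ 4 := by
      calc N ^ 3 ≤ (N + 1) ^ 3 := pow_le_pow_left₀ hN0 (by linarith) 3
        _ ≤ (N + 1) ^ 4 := pow_le_pow_right₀ (by linarith) (by norm_num)
    have h2 : η ^ 2 = ε ^ 2 / (16 * (N + 1) ^ 4) := by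
      rw [hη, div_pow]
      ring
    rw [h2, mul_div_assoc', div_mul_eq_mul_div, div_le_iff₀ (by positivity)]
    nlinarith [mul_le_mul_of_nonneg_left h1 (sq_nonneg ε),
      mul_nonneg (sq_nonneg ε) (by positivity : 0 ≤ (N + 1) ^ 4)]
  set c : ℝ := (ε / 2) ^ 2 / 4 with hc
  have hc0 : 0 < c := by positivity
  -- Coefficients of `1 / n` in the failure bound: noise, diagonal of the truncation error, Gram
  -- matrix.
  set A : ℝ := 32 / ε ^ 4 + 4 * K.card ^ 2 / ε ^ 2 + N ^ 2 / η ^ 2 with hA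
  have hlim : Tendsto (fun n : ℕ => n * (2 * Real.exp (-c * n)) + A / n + ρ / 4) atTop
      (𝓝 (0 + 0 + ρ / 4)) := by
    refine (Tendsto.add ?_ (tendsto_const_div_atTop_nhds_zero_nat A)).add_const _
    have h1 : Tendsto (fun n : ℕ => c * (n : ℝ)) atTop atTop :=
      tendsto_natCast_atTop_atTop.const_mul_atTop hc0
    have h2 := ((Real.tendsto_pow_mul_exp_neg_atTop_nhds_zero 1).comp h1).const_mul (2 / c)
    rw [mul_zero] at h2
    refine h2.congr fun n => ?_
    simp only [Function.comp_apply, pow_one, neg_mul]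
    field_simp
  have hmul : Tendsto (fun m : ℕ => 2 * m) atTop atTop :=
    tendsto_id.const_mul_atTop' (by norm_num)
  have hev : ∀ᶠ n : ℕ in atTop, n * (2 * Real.exp (-c * n)) + A / n + ρ / 4 < ρ :=
    hlim.eventually_lt_const (by linarith)
  have hev2 : ∀ᶠ n : ℕ in atTop, 2 / ε ≤ n :=
    tendsto_natCast_atTop_atTop.eventually_ge_atTop _
  filter_upwards [hmul.eventually hev, hmul.eventually hev2,
    hmul.eventually (eventually_gt_atTop 0)] with m h1 h2 h3
  generalize 2 * m = n at h1 h2 h3 ⊢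
  have hn' : (0 : ℝ) < n := by exact_mod_cast h3
  refine (SGBM.law_loss_pos_le hFi hFo hL hL0 hγ hgap hε0 hε1 hεγ hεL hK0 hK hη0 hηJ hηε h3 h2
    (hest n h3)).trans (le_trans (ENNReal.ofReal_le_ofReal ?_) hρ)
  refine le_trans (le_of_eq ?_) h1.le
  rw [← hc, ← hN, hA]
  clear_value η c N
  field_simp
  ring
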